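/- All semigroups are nonempty. A pseudovariety of (ordered) semigroups is a class of finite (ordered) semigroups closed under homomorphic images, (ordered) subsemigroups and finite direct products; here an ordered semigroup is a semigroup with a partial order $\le$ such that $s\le t$ implies $sa\le ta$ and $as\le at$, and homomorphisms of ordered semigroups are isotone. A pseudovariety $\mathsf V$ of semigroups is also viewed as the pseudovariety of ordered semigroups consisting of all members of $\mathsf V$ equipped with every possible stable partial order. A pseudovariety $\mathsf V$ of semigroups is \emph{order primitive} if it is not generated by a proper subpseudovariety of ordered semigroups, that is, if there is no pseudovariety of ordered semigroups $\mathsf W\subsetneq\mathsf V$ such that $\mathsf V$ is the pseudovariety of semigroups generated by the underlying semigroups of the members of $\mathsf W$. Let $\mathsf{CR}$ be the pseudovariety of all finite completely regular semigroups (every element lies in a subgroup), $\mathsf G$ that of all finite groups, and $\mathsf A$ that of all finite aperiodic semigroups (all subgroups are trivial). For pseudovarieties of semigroups $\mathsf V,\mathsf W$, let $\mathsf V*\mathsf W$ be the pseudovariety generated by all semidirect products $S*T$ with $S\in\mathsf V$ and $T\in\mathsf W$, where $T$ acts on $S$ on the left by endomorphisms (an identity element of $T$, if there is one, acting identically) and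 $(s,t)(s',t')=(s\cdot{}^{t}s',\,tt')$. The Krohn--Rhodes complexity pseudovarieties are $\mathsf C_0=\mathsf A$ and $\mathsf C_{n+1}=\mathsf C_n*\mathsf G*\mathsf A$. Corollary. For every $n\ge 0$, the class $\mathsf{CR}\cap\mathsf C_n$ is an order primitive pseudovariety of semigroups. -/

import Mathlib

/-- A finite (nonempty) semigroup. Up to isomorphism every finite semigroup lives on a type in
`Type`, so classes of finite semigroups closed under isomorphism are subsets of this type. -/
structure FinSgp where
  carrier : Type
  semigroup : Semigroup carrier
  finite : Finite carrier
  nonempty : Nonempty carrier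

namespace FinSgp

instance : CoeSort FinSgp Type := ⟨FinSgp.carrier⟩

attribute [instance] FinSgp.semigroup FinSgp.finite FinSgp.nonempty

/-- The one-element semigroup (the empty product). -/
def trivial : FinSgp where
  carrier := PUnit
  semigroup := inferInstance
  finite := inferInstance
  nonempty := inferInstance

/-- The direct product of two finite semigroups. -/
def prod (S T : FinSgp) : FinSgp where
  carrier := S × T
  semigroup := inferInstance
  finite := inferInstance
  nonempty := inferInstance

/-- The semigroup `S` is a group under its multiplication. -/
def IsGrp (S : Type*) [Semigroup S] : Prop :=
  ∃ e : S, (∀ x, e * x = x ∧ x * e = x) ∧ ∀ x, ∃ y, y * x = e ∧ x * y = e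

/-- Pseudovarieties of semigroups: classes of finite semigroups closed under homomorphic images,
subsemigroups and finite direct products. In the presence of closure under homomorphic images
(hence under isomorphism), closure under subsemigroups is closure under embeddings. Finite
products are given by the empty product and binary products. -/
structure IsPseudovariety (V : Set FinSgp) : Prop where
  image_mem : ∀ {S T : FinSgp}, S ∈ V → ∀ f : S →ₙ* T, Function.Surjective f → T ∈ V
  sub_mem : ∀ {S T : FinSgp}, T ∈ V → ∀ f : S →ₙ* T, Function.Injective f → S ∈ V
  trivial_mem : trivial ∈ V
  prod_mem : ∀ {S T : FinSgp}, S ∈ V → T ∈ V → prod S T ∈ V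

/-- The pseudovariety of semigroups generated by a class of finite semigroups: the least
pseudovariety containing the class. -/
def generated (K : Set FinSgp) : Set FinSgp :=
  {S | ∀ V : Set FinSgp, IsPseudovariety V → K ⊆ V → S ∈ V}

/-- The class `CR` of finite completely regular semigroups: every element lies in a subgroup. -/
def CR : Set FinSgp :=
  {S | ∀ x : S, ∃ H : Subsemigroup S, x ∈ H ∧ IsGrp H}

/-- The class `A` of finite aperiodic semigroups: all subgroups are trivial. -/
def A : Set FinSgp :=
  {S | ∀ H : Subsemigroup S, IsGrp H → ∀ x ∈ H, ∀ y ∈ H, x = y}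

/-- The class `G` of finite groups. -/
def G : Set FinSgp :=
  {S | IsGrp S}

/-- A left action of the semigroup `T` on the semigroup `S` by endomorphisms. If `T` has an
identity element, it acts as the identity map. Equivalently: a monoid homomorphism from `T¹` to
the monoid of endomorphisms of `S`, where `T¹` is `T` if `T` has an identity element, and `T` with
an identity element adjoined otherwise. -/
structure Action (T S : Type) [Semigroup T] [Semigroup S] where
  act : T → S → S
  mul_act : ∀ t t' s, act (t * t') s = act t (act t' s)
  act_mul : ∀ t s s', act t (s * s') = act t s * act t s'
  one_act : ∀ e : T, (∀ t, e * t = t ∧ t * e = t) → ∀ s, act e s = s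

/-- The underlying set of the semidirect product of `S` and `T` along a left action of `T`
on `S`. -/
@[ext]
structure Semidirect {T S : Type} [Semigroup T] [Semigroup S] (φ : Action T S) where
  left : S
  right : T

/-- The multiplication `(s, t) (s', t') = (s · ᵗs', t t')`. -/
instance {T S : Type} [Semigroup T] [Semigroup S] (φ : Action T S) :
    Semigroup (Semidirect φ) where
  mul p q := ⟨p.left * φ.act p.right q.left, p.right * q.right⟩
  mul_assoc p q r := by
    apply Semidirect.ext
    · change p.left * φ.act p.right q.left * φ.act (p.right * q.right) r.left =
        p.left * φ.act p.right (q.left * φ.act q.right r.left)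
      rw [φ.act_mul, φ.mul_act, mul_assoc]
    · exact mul_assoc p.right q.right r.right

/-- The semidirect product of two finite semigroups as a finite semigroup. -/
def semidirect (S T : FinSgp) (φ : Action T S) : FinSgp where
  carrier := Semidirect φ
  semigroup := inferInstance
  finite := Finite.of_injective (fun p : Semidirect φ => (p.left, p.right)) (by
    intro p q h
    exact Semidirect.ext (congrArg Prod.fst h) (congrArg Prod.snd h))
  nonempty := ⟨⟨Classical.arbitrary S, Classical.arbitrary T⟩⟩

/-- `V * W`: the pseudovariety generated by all semidirect products of some `S ∈ V` and some
`T ∈ W`. -/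
def star (V W : Set FinSgp) : Set FinSgp :=
  generated {R | ∃ S ∈ V, ∃ T ∈ W, ∃ φ : Action T S, R = semidirect S T φ}

/-- The Krohn-Rhodes complexity pseudovarieties: `C₀ = A` and `Cₙ₊₁ = Cₙ * G * A`. -/
def C : ℕ → Set FinSgp
  | 0 => A
  | n + 1 => star (star (C n) G) A

end FinSgp

/-- A finite (nonempty) ordered semigroup: a finite semigroup with a stable partial order. The
field `toFinSgp` is the underlying semigroup. -/
structure OrdFinSgp extends FinSgp where
  order : PartialOrder carrier
  stable : ∀ a s t : carrier, s ≤ t → s * a ≤ t * a ∧ a * s ≤ a * t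

namespace OrdFinSgp

instance : CoeSort OrdFinSgp Type := ⟨fun S => S.carrier⟩

attribute [instance] OrdFinSgp.order

/-- The one-element ordered semigroup. -/
def trivial : OrdFinSgp where
  toFinSgp := FinSgp.trivial
  order := (inferInstance : PartialOrder PUnit.{1})
  stable := fun _ _ _ _ => ⟨le_refl PUnit.unit.{1}, le_refl PUnit.unit.{1}⟩

/-- The direct product of two finite ordered semigroups, with the componentwise order. -/
def prod (S T : OrdFinSgp) : OrdFinSgp where
  toFinSgp := FinSgp.prod S.toFinSgp T.toFinSgp
  order := Prod.instPartialOrder S T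
  stable := fun a s t h =>
    ⟨⟨(S.stable a.1 s.1 t.1 h.1).1, (T.stable a.2 s.2 t.2 h.2).1⟩,
      ⟨(S.stable a.1 s.1 t.1 h.1).2, (T.stable a.2 s.2 t.2 h.2).2⟩⟩

/-- Pseudovarieties of ordered semigroups: classes of finite ordered semigroups closed under
images by isotone homomorphisms, subsemigroups with the induced order, and finite direct
products. -/
structure IsPseudovariety (W : Set OrdFinSgp) : Prop where
  image_mem : ∀ {S T : OrdFinSgp}, S ∈ W →
    ∀ f : S →ₙ* T, Monotone f → Function.Surjective f → T ∈ W
  sub_mem : ∀ {S T : OrdFinSgp}, T ∈ W →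
    ∀ f : S →ₙ* T, (∀ x y, f x ≤ f y ↔ x ≤ y) → S ∈ W
  trivial_mem : trivial ∈ W
  prod_mem : ∀ {S T : OrdFinSgp}, S ∈ W → T ∈ W → prod S T ∈ W

/-- The class of all members of `V`, each equipped with every possible stable partial order. -/
def ofUnordered (V : Set FinSgp) : Set OrdFinSgp :=
  {S | S.toFinSgp ∈ V}

end OrdFinSgp

/-- A class `V` of finite semigroups is an order primitive pseudovariety if it is a pseudovariety
of semigroups and there is no pseudovariety `W` of ordered semigroups that is properly contained
in `V` (viewed as the class of its members with all stable partial orders) and that generates `V`,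
in the sense that `V` is the pseudovariety of semigroups generated by the underlying semigroups of
the members of `W`. -/
def IsOrderPrimitive (V : Set FinSgp) : Prop :=
  FinSgp.IsPseudovariety V ∧
    ¬ ∃ W : Set OrdFinSgp, OrdFinSgp.IsPseudovariety W ∧ W ⊂ OrdFinSgp.ofUnordered V ∧
      FinSgp.generated (OrdFinSgp.toFinSgp '' W) = V

/-! Write `V` for the class in question, let `W` be a pseudovariety of ordered semigroups inside `V`
that generates `V`, and let `S ∈ V` carry any stable order. It is enough to find `T ∈ W` all of
whose inequalities in at most `|S|` letters are identities of `S` (`mem_of_inequalities`). Then the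
canonical map onto `S` from the relatively free ordered semigroup of `T` sends comparable elements
to equal ones, so it is isotone for every order on `S`. Every member of `V` divides a member of `W`,
so what is needed is an `M₁ ∈ V` such that any ordered theory whose identities hold in `M₁` has, in
`|S|` letters, only inequalities that are identities of `M = S¹`. This is `Determines`.

Such an `M₁` is built by induction on the number of letters, with step `M × Plus M₁ Unit × Minus M₁
Unit` (`Determines.succ`). The driving fact is that a group of finite exponent has no nontrivial
stable order: `1 ≤ k` gives `1 ≤ k ≤ k² ≤ … ≤ k^N = 1`. Let `u ≤ v` hold in the theory. The left
zeros of `Plus M₁ Unit` force `u` and `v` to have the same letters and the same last new letter `y`.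
With `u = u' y w` and `v = v' y w'`, the pair `u'`, `v'` is an inequality of the theory of prefixes,
which `M₁` models, so by induction `u'` and `v'` agree in `M`. By complete regularity `u` is
R-equivalent to `u' y`; hence the value of `v` in `M` is a right multiple of that of `u`, and dually
a left multiple. The group fact gives the identity `u = u^N v u^N`, whose right side then has the
value of `v`.

There remains the closure of `V` under adjoining an identity and under `Plus` and `Minus`. The added
zeros are idempotents, which settles `CR`. For `C n` the property `ZeroClosed` holds for `A` and is
preserved by `* A` and `* G`, because both constructions over a semidirect product divide a
semidirect product of such constructions. -/

open FreeMonoid in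
/-- An ordered equational theory of completely regular semigroups of finite exponent: a stable
preorder on words over `ℕ` that is invariant under nonerasing substitutions, and for which all
words are equivalent to a fixed proper power of themselves. -/
structure OrdTheory where
  le : FreeMonoid ℕ → FreeMonoid ℕ → Prop
  N : ℕ
  N_pos : 0 < N
  refl : ∀ u, le u u
  trans : ∀ {u v w}, le u v → le v w → le u w
  mul_left : ∀ {u v} w, le u v → le (w * u) (w * v)
  mul_right : ∀ {u v} w, le u v → le (u * w) (v * w)
  subst : ∀ {u v} (σ : ℕ → FreeMonoid ℕ), (∀ x, σ x ≠ 1) → le u v → le (lift σ u) (lift σ v)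
  pow_le : ∀ u, le (u ^ (N + 1)) u
  le_pow : ∀ u, le u (u ^ (N + 1))

/-! ### Relatively free ordered monoids and their local groups -/

namespace OrdTheory

open FreeMonoid

/-- The fully invariant congruence of a theory. -/
def con (T : OrdTheory) : Con (FreeMonoid ℕ) where
  r u v := T.le u v ∧ T.le v u
  iseqv := ⟨fun u => ⟨T.refl u, T.refl u⟩, fun h => ⟨h.2, h.1⟩,
    fun h k => ⟨T.trans h.1 k.1, T.trans k.2 h.2⟩⟩
  mul' h k := ⟨T.trans (T.mul_right _ h.1) (T.mul_left _ k.1),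
    T.trans (T.mul_right _ h.2) (T.mul_left _ k.2)⟩

/-- The relatively free ordered monoid of a theory. -/
abbrev Free (T : OrdTheory) : Type := T.con.Quotient

variable (T : OrdTheory)

/-- The class of a word. -/
abbrev q : FreeMonoid ℕ →* T.Free := T.con.mk'

theorem q_surjective : Function.Surjective T.q := Con.mk'_surjective

variable {T}

theorem q_eq_iff {u v : FreeMonoid ℕ} : T.q u = T.q v ↔ T.le u v ∧ T.le v u := T.con.eq

instance : PartialOrder T.Free where
  le a b := ∃ u v, T.q u = a ∧ T.q v = b ∧ T.le u v
  le_refl a := by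
    obtain ⟨u, rfl⟩ := T.q_surjective a
    exact ⟨u, u, rfl, rfl, T.refl u⟩
  le_trans := by
    rintro _ _ _ ⟨u, v, rfl, rfl, h⟩ ⟨v', w, hv, rfl, h'⟩
    exact ⟨u, w, rfl, rfl, T.trans h (T.trans (q_eq_iff.1 hv).2 h')⟩
  le_antisymm := by
    rintro _ _ ⟨u, v, rfl, rfl, h⟩ ⟨v', u', hv, hu, h'⟩
    exact q_eq_iff.2 ⟨h, T.trans (q_eq_iff.1 hv).2 (T.trans h' (q_eq_iff.1 hu).1)⟩

theorem q_le_iff {u v : FreeMonoid ℕ} : T.q u ≤ T.q v ↔ T.le u v := by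
  constructor
  · rintro ⟨u', v', hu, hv, h⟩
    exact T.trans (q_eq_iff.1 hu).2 (T.trans h (q_eq_iff.1 hv).1)
  · exact fun h => ⟨u, v, rfl, rfl, h⟩

theorem mul_le_left {a b : T.Free} (c : T.Free) (h : a ≤ b) : c * a ≤ c * b := by
  obtain ⟨u, v, rfl, rfl, h⟩ := h
  obtain ⟨w, rfl⟩ := T.q_surjective c
  simpa only [← map_mul, q_le_iff] using T.mul_left w h

theorem mul_le_right {a b : T.Free} (c : T.Free) (h : a ≤ b) : a * c ≤ b * c := by
  obtain ⟨u, v, rfl, rfl, h⟩ := h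
  obtain ⟨w, rfl⟩ := T.q_surjective c
  simpa only [← map_mul, q_le_iff] using T.mul_right w h

theorem pow_N_succ (a : T.Free) : a ^ (T.N + 1) = a := by
  obtain ⟨u, rfl⟩ := T.q_surjective a
  rw [← map_pow]
  exact q_eq_iff.2 ⟨T.pow_le u, T.le_pow u⟩

theorem pow_N_mul (a : T.Free) : a ^ T.N * a = a := by rw [← pow_succ, pow_N_succ]

theorem mul_pow_N (a : T.Free) : a * a ^ T.N = a := by rw [← pow_succ', pow_N_succ]

theorem pow_mul_pow_N (a : T.Free) : ∀ {k : ℕ}, 0 < k → a ^ k * a ^ T.N = a ^ k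
  | k + 1, _ => by rw [pow_succ, mul_assoc, mul_pow_N]

theorem pow_N_idem (a : T.Free) : a ^ T.N * a ^ T.N = a ^ T.N := pow_mul_pow_N a T.N_pos

theorem pow_pred_mul (a : T.Free) : a ^ (T.N - 1) * a = a ^ T.N := by
  rw [← pow_succ, Nat.sub_add_cancel T.N_pos]

theorem mul_pow_pred (a : T.Free) : a * a ^ (T.N - 1) = a ^ T.N := by
  rw [← pow_succ', Nat.sub_add_cancel T.N_pos]

/-- A repeated letter can be undone on the right: the left side is `p * x * (r * x) ^ N * r`, which
equals `p * (x * r) ^ N * (x * r)`. -/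
theorem absorb_letter (p x r : T.Free) : p * x * r * x * ((r * x) ^ (T.N - 1) * r) = p * x * r := by
  have h : (r * x) * (r * x) ^ (T.N - 1) = (r * x) ^ T.N := mul_pow_pred _
  have h2 : ∀ k : ℕ, x * (r * x) ^ k = (x * r) ^ k * x := by
    intro k
    induction k with
    | zero => simp
    | succ k ih => rw [pow_succ, ← mul_assoc, ih, pow_succ]; simp only [mul_assoc]
  calc p * x * r * x * ((r * x) ^ (T.N - 1) * r)
      = p * (x * ((r * x) * (r * x) ^ (T.N - 1))) * r := by simp only [mul_assoc]
    _ = p * ((x * r) ^ T.N * (x * r)) := by rw [h, h2]; simp only [mul_assoc]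
    _ = p * x * r := by rw [pow_N_mul, mul_assoc]

theorem exists_eq_of_mem {x : ℕ} {u : FreeMonoid ℕ} (h : x ∈ u.symbols) :
    ∃ p r, u = p * of x * r := by
  rw [mem_symbols] at h
  obtain ⟨s, t, h⟩ := List.append_of_mem h
  refine ⟨ofList s, ofList t, ?_⟩
  rw [mul_assoc]
  exact h

/-- Multiplying by letters that already occur does not leave the R-class; `absorb_letter` removes
them one at a time. -/
theorem exists_mul_eq (Z a : FreeMonoid ℕ) (h : a.symbols ⊆ Z.symbols) :
    ∃ b, T.q Z * T.q a * b = T.q Z := by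
  induction a using FreeMonoid.inductionOn' generalizing Z with
  | one => exact ⟨1, by simp⟩
  | of_mul x a ih =>
    rw [symbols_mul, symbols_of, Finset.union_subset_iff, Finset.singleton_subset_iff] at h
    obtain ⟨p, r, hZ⟩ := exists_eq_of_mem h.1
    obtain ⟨b, hb⟩ := ih (Z * of x) (h.2.trans (by simp))
    refine ⟨b * ((T.q r * T.q (of x)) ^ (T.N - 1) * T.q r), ?_⟩
    have h1 : T.q Z * T.q (of x * a) * b = T.q Z * T.q (of x) := by
      refine Eq.trans ?_ (hb.trans (map_mul _ _ _))
      simp only [map_mul, mul_assoc]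
    rw [← mul_assoc, h1, hZ]
    simpa only [map_mul] using absorb_letter _ _ _

theorem symbols_pow (u : FreeMonoid ℕ) {k : ℕ} (hk : 0 < k) : (u ^ k).symbols = u.symbols := by
  induction k with
  | zero => omega
  | succ k ih =>
    rcases Nat.eq_zero_or_pos k with rfl | h
    · simp
    · rw [pow_succ, symbols_mul, ih h, Finset.union_self]

theorem symbols_pow_subset (u : FreeMonoid ℕ) (k : ℕ) : (u ^ k).symbols ⊆ u.symbols := by
  rcases Nat.eq_zero_or_pos k with rfl | h
  · simp
  · rw [symbols_pow u h]

variable (T) in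
/-- The local group of units at the idempotent power of a word `Z`, consisting of the classes of
words with letters in `Z`. -/
def localGroup (Z : FreeMonoid ℕ) : Set T.Free :=
  {k | ∃ a : FreeMonoid ℕ, a.symbols ⊆ Z.symbols ∧ k = T.q Z ^ T.N * T.q a * T.q Z ^ T.N}

section localGroup

variable {Z : FreeMonoid ℕ} {k l : T.Free}

theorem mem_localGroup {a : FreeMonoid ℕ} (h : a.symbols ⊆ Z.symbols) :
    T.q Z ^ T.N * T.q a * T.q Z ^ T.N ∈ T.localGroup Z := ⟨a, h, rfl⟩

theorem localGroup_left (hk : k ∈ T.localGroup Z) : T.q Z ^ T.N * k = k := by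
  obtain ⟨a, -, rfl⟩ := hk
  simp only [← mul_assoc, pow_N_idem]

theorem localGroup_right (hk : k ∈ T.localGroup Z) : k * T.q Z ^ T.N = k := by
  obtain ⟨a, -, rfl⟩ := hk
  simp only [mul_assoc, pow_N_idem]

theorem localGroup_mul (hk : k ∈ T.localGroup Z) (hl : l ∈ T.localGroup Z) :
    k * l ∈ T.localGroup Z := by
  obtain ⟨a, ha, rfl⟩ := hk
  obtain ⟨b, hb, rfl⟩ := hl
  refine ⟨a * Z ^ T.N * b, ?_, ?_⟩
  · simp only [symbols_mul, Finset.union_subset_iff]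
    exact ⟨⟨ha, symbols_pow_subset _ _⟩, hb⟩
  · have := pow_N_idem (T.q Z)
    simp only [map_mul, map_pow, mul_assoc]
    rw [← mul_assoc (T.q Z ^ T.N) (T.q Z ^ T.N), this]

/-- Let `e` be the idempotent. `exists_mul_eq` gives `k * b = e`, and then `k ^ N = k ^ N * e = k ^
N * k * b = k * b = e`. -/
theorem localGroup_pow (hk : k ∈ T.localGroup Z) : k ^ T.N = T.q Z ^ T.N := by
  obtain ⟨a, ha, hk'⟩ := id hk
  have hb : ∃ b, k * b = T.q Z ^ T.N := by
    have hs : (a * Z ^ T.N).symbols ⊆ (Z ^ T.N).symbols := by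
      rw [symbols_mul, symbols_pow _ T.N_pos]
      exact Finset.union_subset ha le_rfl
    obtain ⟨b, hb⟩ := exists_mul_eq (T := T) _ _ hs
    refine ⟨b, ?_⟩
    rw [hk', ← map_pow]
    refine Eq.trans ?_ hb
    simp only [map_mul, mul_assoc]
  obtain ⟨b, hb⟩ := hb
  have h1 : k ^ T.N * T.q Z ^ T.N = k ^ T.N := by
    rw [← pow_pred_mul, mul_assoc, localGroup_right hk]
  rw [← h1, ← hb, ← mul_assoc, pow_N_mul]

theorem localGroup_inv (hk : k ∈ T.localGroup Z) :
    ∃ l ∈ T.localGroup Z, k * l = T.q Z ^ T.N ∧ l * k = T.q Z ^ T.N := by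
  have h1 : T.q Z ^ T.N ∈ T.localGroup Z :=
    ⟨1, by simp, by rw [map_one, mul_one, pow_N_idem]⟩
  have h2 : ∀ i : ℕ, T.q Z ^ T.N * k ^ i ∈ T.localGroup Z := by
    intro i
    induction i with
    | zero => simpa using h1
    | succ i ih => rw [pow_succ, ← mul_assoc]; exact localGroup_mul ih hk
  refine ⟨_, h2 (T.N - 1), ?_, ?_⟩
  · rw [← mul_assoc, localGroup_right hk, mul_pow_pred, localGroup_pow hk]
  · rw [mul_assoc, pow_pred_mul, localGroup_pow hk, pow_N_idem]

theorem le_mul_pow {c d : T.Free} (h : c ≤ c * d) : ∀ i : ℕ, c ≤ c * d ^ i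
  | 0 => by simp
  | i + 1 => by
    rw [pow_succ', ← mul_assoc]
    exact h.trans (by simpa only [pow_succ', mul_assoc] using
      (le_mul_pow (c := c * d) (by simpa only [mul_assoc] using mul_le_right d h) i))

/-- Triviality of the order on groups of finite exponent: iterating the hypothesis gives `c * k ≤ c
* k * k ^ (N - 1) = c`. -/
theorem mul_eq_of_le {c : T.Free} (hk : k ∈ T.localGroup Z) (hc : c * T.q Z ^ T.N = c)
    (h : c ≤ c * k) : c * k = c := by
  refine le_antisymm ?_ h
  have h2 := le_mul_pow (mul_le_right k h) (T.N - 1)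
  rwa [mul_assoc, mul_pow_pred, localGroup_pow hk, hc] at h2

theorem eq_of_le_localGroup (hk : k ∈ T.localGroup Z) (h : T.q Z ^ T.N ≤ k) :
    k = T.q Z ^ T.N := by
  have := mul_eq_of_le (c := T.q Z ^ T.N) hk (pow_N_idem _) (by rwa [localGroup_left hk])
  rwa [localGroup_left hk] at this

end localGroup

end OrdTheory

/-! ### Adjoining left zeros or right zeros to a monoid -/

/-- The monoid `M` together with a set `M × X` of left zeros on which `M` acts from the left. -/
inductive Plus (M X : Type) : Type
  | el : M → Plus M X
  | zero : M → X → Plus M X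

/-- The monoid `M` together with a set `X × M` of right zeros on which `M` acts from the right. -/
inductive Minus (M X : Type) : Type
  | el : M → Minus M X
  | zero : X → M → Minus M X

namespace Plus

variable {M X : Type}

instance [Mul M] : Mul (Plus M X) where
  mul
    | el m, el n => el (m * n)
    | el m, zero n x => zero (m * n) x
    | zero m x, _ => zero m x

section

variable [Mul M]

@[simp] theorem el_mul_el (m n : M) : (el m * el n : Plus M X) = el (m * n) := rfl
@[simp] theorem el_mul_zero (m n : M) (x : X) : el m * zero n x = zero (m * n) x := rfl
@[simp] theorem zero_mul (m : M) (x : X) (a : Plus M X) : zero m x * a = zero m x := rfl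

end

instance [Monoid M] : Monoid (Plus M X) where
  one := el 1
  mul_assoc := by rintro (_ | _) (_ | _) (_ | _) <;> simp [mul_assoc]
  one_mul := by
    rintro (m | ⟨m, x⟩)
    · exact congrArg el (one_mul m)
    · exact congrArg (zero · x) (one_mul m)
  mul_one := by
    rintro (m | ⟨m, x⟩)
    · exact congrArg el (mul_one m)
    · rfl

instance [Finite M] [Finite X] : Finite (Plus M X) :=
  Finite.of_injective
    (fun a : Plus M X => (match a with | el m => Sum.inl m | zero m x => Sum.inr (m, x) :
      M ⊕ (M × X))) (by rintro (_ | _) (_ | _) <;> simp)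

end Plus

namespace Minus

variable {M X : Type}

instance [Mul M] : Mul (Minus M X) where
  mul
    | el m, el n => el (m * n)
    | zero x m, el n => zero x (m * n)
    | _, zero x m => zero x m

section

variable [Mul M]

@[simp] theorem el_mul_el (m n : M) : (el m * el n : Minus M X) = el (m * n) := rfl
@[simp] theorem zero_mul_el (m n : M) (x : X) : zero x m * el n = zero x (m * n) := rfl
@[simp] theorem mul_zero (m : M) (x : X) : ∀ a : Minus M X, a * zero x m = zero x m
  | el _ => rfl
  | zero _ _ => rfl

end

instance [Monoid M] : Monoid (Minus M X) where
  one := el 1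
  mul_assoc := by rintro (_ | _) (_ | _) (_ | _) <;> simp [mul_assoc]
  one_mul := by
    rintro (m | ⟨x, m⟩)
    · exact congrArg el (one_mul m)
    · rfl
  mul_one := by
    rintro (m | ⟨x, m⟩)
    · exact congrArg el (mul_one m)
    · exact congrArg (zero x ·) (mul_one m)

theorem one_def [Monoid M] : (1 : Minus M X) = el 1 := rfl

instance [Finite M] [Finite X] : Finite (Minus M X) :=
  Finite.of_injective
    (fun a : Minus M X => (match a with | el m => Sum.inl m | zero x m => Sum.inr (m, x) :
      M ⊕ (M × X))) (by rintro (_ | _) (_ | _) <;> simp +contextual)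

/-- `Minus` is dual to `Plus`. -/
def ofPlusOp : Plus Mᵐᵒᵖ X → Minus M X
  | .el m => el m.unop
  | .zero m x => zero x m.unop

end Minus

/-! ### Models, reversal and the theory of prefixes -/

namespace OrdTheory

open FreeMonoid

section words

variable {M : Type} [Monoid M]

theorem lift_congr {η θ : ℕ → M} {u : FreeMonoid ℕ} (h : ∀ x ∈ u.symbols, η x = θ x) :
    lift η u = lift θ u := by
  induction u using FreeMonoid.inductionOn' with
  | one => simp
  | of_mul x u ih =>
    rw [map_mul, map_mul, lift_eval_of, lift_eval_of, h x (by simp),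
      ih fun y hy => h y (by simp_all)]

theorem lift_of (u : FreeMonoid ℕ) : lift of u = u :=
  DFunLike.congr_fun (lift_restrict (MonoidHom.id (FreeMonoid ℕ))) u

theorem lift_update_of_notMem {η : ℕ → M} {u : FreeMonoid ℕ} {y : ℕ} (m : M)
    (h : y ∉ u.symbols) : lift (Function.update η y m) u = lift η u :=
  lift_congr fun x hx => Function.update_of_ne (by rintro rfl; exact h hx) _ _

theorem lift_lift (σ : ℕ → FreeMonoid ℕ) (η : ℕ → M) (u : FreeMonoid ℕ) :
    lift η (lift σ u) = lift (fun x => lift η (σ x)) u := by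
  induction u using FreeMonoid.inductionOn' with
  | one => simp
  | of_mul x u ih => simp [ih]

theorem symbols_lift_subset {σ : ℕ → FreeMonoid ℕ} {u : FreeMonoid ℕ} {B : Finset ℕ}
    (h : ∀ x ∈ u.symbols, (σ x).symbols ⊆ B) : (lift σ u).symbols ⊆ B := by
  induction u using FreeMonoid.inductionOn' with
  | one => simp
  | of_mul x u ih =>
    rw [map_mul, lift_eval_of, symbols_mul]
    exact Finset.union_subset (h x (by simp)) (ih fun y hy => h y (by simp_all))

theorem map_lift_reverse {M' : Type} [Monoid M'] (θ : M' → M) (h1 : θ 1 = 1)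
    (hθ : ∀ a b, θ (a * b) = θ b * θ a) (η : ℕ → M') (u : FreeMonoid ℕ) :
    θ (lift η u) = lift (fun x => θ (η x)) u.reverse := by
  induction u using FreeMonoid.inductionOn' with
  | one => exact h1
  | of_mul x u ih =>
    rw [map_mul, hθ, ih, reverse_mul, map_mul, reverse_of, lift_eval_of, lift_eval_of]

theorem symbols_reverse (u : FreeMonoid ℕ) : u.reverse.symbols = u.symbols :=
  List.toFinset_reverse

theorem mul_ne_one_left {u : FreeMonoid ℕ} (v : FreeMonoid ℕ) (h : u ≠ 1) : u * v ≠ 1 := by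
  intro h'
  apply h
  have := congrArg FreeMonoid.length h'
  rw [length_mul, length_one] at this
  exact length_eq_zero.1 (by omega)

theorem reverse_ne_one {u : FreeMonoid ℕ} (h : u ≠ 1) : u.reverse ≠ 1 := by
  intro h'
  apply h
  rw [← reverse_reverse (a := u), h']
  rfl

end words

/-- The monoid `M` satisfies all identities of the theory. -/
def Models (T : OrdTheory) (M : Type) [Monoid M] : Prop :=
  ∀ u v, T.q u = T.q v → ∀ η : ℕ → M, lift η u = lift η v

theorem Models.of_surjective {T : OrdTheory} {M M' : Type} [Monoid M] [Monoid M']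
    (h : T.Models M) (f : M →* M') (hf : Function.Surjective f) : T.Models M' := by
  intro u v huv η
  obtain ⟨g, hg⟩ := hf.hasRightInverse
  have := congrArg f (h u v huv (g ∘ η))
  have h2 : f ∘ g ∘ η = η := funext fun x => hg (η x)
  simpa only [← MonoidHom.comp_apply, comp_lift, h2] using this

/-- The theory of the reversed words. -/
def op (T : OrdTheory) : OrdTheory where
  le u v := T.le u.reverse v.reverse
  N := T.N
  N_pos := T.N_pos
  refl _ := T.refl _
  trans := T.trans
  mul_left w h := by simpa only [reverse_mul] using T.mul_right _ h
  mul_right w h := by simpa only [reverse_mul] using T.mul_left _ h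
  subst {u v} σ hσ h := by
    have hm := map_lift_reverse (reverse : FreeMonoid ℕ → FreeMonoid ℕ) rfl
      (fun _ _ => reverse_mul) σ
    rw [hm, hm]
    exact T.subst _ (fun x => reverse_ne_one (hσ x)) h
  pow_le u := by
    rw [show (u ^ (T.N + 1)).reverse = u.reverse ^ (T.N + 1) from reverse_pow u _]
    exact T.pow_le _
  le_pow u := by
    rw [show (u ^ (T.N + 1)).reverse = u.reverse ^ (T.N + 1) from reverse_pow u _]
    exact T.le_pow _
where
  reverse_pow (u : FreeMonoid ℕ) (k : ℕ) : (u ^ k).reverse = u.reverse ^ k := by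
    induction k with
    | zero => rfl
    | succ k ih => rw [pow_succ, reverse_mul, ih, pow_succ']

theorem Models.op {T : OrdTheory} {M M' : Type} [Monoid M] [Monoid M'] (h : T.Models M)
    (θ : M' → M) (h1 : θ 1 = 1) (hθ : ∀ a b, θ (a * b) = θ b * θ a) (hi : Function.Injective θ) :
    T.op.Models M' := by
  intro u v huv η
  apply hi
  rw [map_lift_reverse θ h1 hθ, map_lift_reverse θ h1 hθ]
  exact h _ _ (q_eq_iff.2 ⟨(q_eq_iff.1 huv).1, (q_eq_iff.1 huv).2⟩) _

theorem Models.op_op {T : OrdTheory} {M : Type} [Monoid M] (h : T.Models M) : T.op.Models Mᵐᵒᵖ :=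
  h.op MulOpposite.unop rfl (fun _ _ => rfl) MulOpposite.unop_injective

theorem Models.plus_of_minus {T : OrdTheory} {M X : Type} [Monoid M] (h : T.Models (Minus M X)) :
    T.op.Models (Plus Mᵐᵒᵖ X) := by
  refine h.op Minus.ofPlusOp rfl ?_ ?_
  · rintro (_ | _) (_ | _) <;> simp [Minus.ofPlusOp]
  · rintro (_ | _) (_ | _) <;> simp +contextual [Minus.ofPlusOp]

theorem exists_fresh (B : Finset ℕ) : ∃ y, y ∉ B := Infinite.exists_notMem_finset B

theorem update_ne_one {σ : ℕ → FreeMonoid ℕ} (hσ : ∀ x, σ x ≠ 1) {y : ℕ} {s : FreeMonoid ℕ}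
    (hs : s ≠ 1) (x : ℕ) : Function.update σ y s x ≠ 1 := by
  by_cases h : x = y
  · subst h; simpa using hs
  · simpa [Function.update_of_ne h] using hσ x

/-- As `y` occurs in neither prefix, its image can be chosen independently of `σ` there; only the
tails, which are irrelevant to `PrefixLE`, feel the choice. -/
theorem subst_fresh {T : OrdTheory} {u v w w' : FreeMonoid ℕ} {y : ℕ} (hu : y ∉ u.symbols)
    (hv : y ∉ v.symbols) (h : T.le (u * of y * w) (v * of y * w')) {σ : ℕ → FreeMonoid ℕ}
    (hσ : ∀ x, σ x ≠ 1) {s : FreeMonoid ℕ} (hs : s ≠ 1) :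
    T.le (lift σ u * s * lift (Function.update σ y s) w)
      (lift σ v * s * lift (Function.update σ y s) w') := by
  have := T.subst _ (update_ne_one hσ (y := y) hs) h
  simpa only [map_mul, lift_eval_of, lift_update_of_notMem _ hu, lift_update_of_notMem _ hv,
    Function.update_self] using this

/-- The preorder which compares prefixes that are followed by a fresh letter. -/
def PrefixLE (T : OrdTheory) (u v : FreeMonoid ℕ) : Prop :=
  ∃ y, y ∉ u.symbols ∧ y ∉ v.symbols ∧ ∃ w w', T.le (u * of y * w) (v * of y * w')

theorem PrefixLE.rename {T : OrdTheory} {u v : FreeMonoid ℕ} (h : T.PrefixLE u v)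
    {σ : ℕ → FreeMonoid ℕ} (hσ : ∀ x, σ x ≠ 1) {s : FreeMonoid ℕ} (hs : s ≠ 1) :
    ∃ w w', T.le (lift σ u * s * w) (lift σ v * s * w') := by
  obtain ⟨y, hu, hv, w, w', h⟩ := h
  exact ⟨_, _, subst_fresh hu hv h hσ hs⟩

theorem PrefixLE.rename_of {T : OrdTheory} {u v : FreeMonoid ℕ} (h : T.PrefixLE u v)
    {s : FreeMonoid ℕ} (hs : s ≠ 1) : ∃ w w', T.le (u * s * w) (v * s * w') := by
  simpa only [lift_of] using h.rename (fun x => of_ne_one x) hs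

theorem PrefixLE.of_le {T : OrdTheory} {u v : FreeMonoid ℕ} (h : T.le u v) : T.PrefixLE u v := by
  obtain ⟨y, hy⟩ := exists_fresh (u.symbols ∪ v.symbols)
  rw [Finset.notMem_union] at hy
  exact ⟨y, hy.1, hy.2, 1, 1, T.mul_right _ (T.mul_right _ h)⟩

/-- The theory of prefixes that are followed by a fresh letter. -/
def prefixTheory (T : OrdTheory) : OrdTheory where
  le := T.PrefixLE
  N := T.N
  N_pos := T.N_pos
  refl u := .of_le (T.refl u)
  trans {u v w} h h' := by
    obtain ⟨y, hy⟩ := exists_fresh (u.symbols ∪ v.symbols ∪ w.symbols)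
    simp only [Finset.notMem_union] at hy
    obtain ⟨a, b, h'⟩ := h'.rename_of (of_ne_one y)
    -- The fresh letter becomes `y * a`, so that the right side of this inequality is the left side
    -- of `h'` multiplied by `d`.
    obtain ⟨c, d, h⟩ := h.rename_of (s := of y * a) (mul_ne_one_left _ (of_ne_one y))
    refine ⟨y, hy.1.1, hy.2, a * c, b * d, ?_⟩
    have := T.mul_right d h'
    simp only [mul_assoc] at this h ⊢
    exact T.trans h this
  mul_left {u v} w h := by
    obtain ⟨y, hy⟩ := exists_fresh (u.symbols ∪ v.symbols ∪ w.symbols)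
    simp only [Finset.notMem_union] at hy
    obtain ⟨a, b, h⟩ := h.rename_of (of_ne_one y)
    refine ⟨y, by simp_all, by simp_all, a, b, ?_⟩
    simpa only [mul_assoc] using T.mul_left w h
  mul_right {u v} w h := by
    obtain ⟨y, hy⟩ := exists_fresh (u.symbols ∪ v.symbols ∪ w.symbols)
    simp only [Finset.notMem_union] at hy
    obtain ⟨a, b, h⟩ := h.rename_of (s := w * of y) (by
      intro h'
      have := congrArg FreeMonoid.length h'
      simp at this)
    refine ⟨y, by simp_all, by simp_all, a, b, ?_⟩
    simpa only [mul_assoc] using h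
  subst {u v} σ hσ h := by
    obtain ⟨y, hy⟩ := exists_fresh ((lift σ u).symbols ∪ (lift σ v).symbols)
    rw [Finset.notMem_union] at hy
    exact ⟨y, hy.1, hy.2, h.rename hσ (of_ne_one y)⟩
  pow_le u := .of_le (T.pow_le u)
  le_pow u := .of_le (T.le_pow u)

/-- Equality of prefixes is defined by two inequalities with four unrelated tails. Triviality of the
order on local groups merges them into one equality in `T`, to which models of `T` can be applied.
-/
theorem exists_eq_of_prefixTheory_eq {T : OrdTheory} {u v : FreeMonoid ℕ}
    (h : T.prefixTheory.q u = T.prefixTheory.q v) :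
    ∃ y, y ∉ u.symbols ∧ y ∉ v.symbols ∧ ∃ w w', T.q (u * of y * w) = T.q (v * of y * w') := by
  obtain ⟨h, h'⟩ := q_eq_iff.1 h
  obtain ⟨y, hy⟩ := exists_fresh (u.symbols ∪ v.symbols)
  rw [Finset.notMem_union] at hy
  obtain ⟨w₁, w₂, h⟩ := PrefixLE.rename_of h (of_ne_one y)
  obtain ⟨w₃, w₄, h'⟩ := PrefixLE.rename_of h' (of_ne_one y)
  -- All four tails use only letters of `Z`. After `y ↦ y * Z ^ N`, each of them acts as an element
  -- of the local group at `Z` and can be inverted.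
  set Z := of y * w₁ * w₂ * w₃ * w₄ with hZ
  have hs : of y * Z ^ T.N ≠ 1 := mul_ne_one_left _ (of_ne_one y)
  have g := subst_fresh hy.1 hy.2 h (fun x => of_ne_one x) hs
  have g' := subst_fresh hy.2 hy.1 h' (fun x => of_ne_one x) hs
  rw [lift_of, lift_of] at g g'
  set τ := Function.update of y (of y * Z ^ T.N) with hτ
  have hyZ : y ∈ Z.symbols := by simp [hZ]
  have hsym : ∀ w : FreeMonoid ℕ, w.symbols ⊆ Z.symbols → (lift τ w).symbols ⊆ Z.symbols := by
    intro w hw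
    refine symbols_lift_subset fun x hx => ?_
    by_cases hxy : x = y
    · subst hxy
      rw [hτ, Function.update_self, symbols_mul, symbols_of]
      exact Finset.union_subset (by simpa using hyZ) (symbols_pow_subset _ _)
    · rw [hτ, Function.update_of_ne hxy, symbols_of]
      simpa using hw hx
  have m₁ := mem_localGroup (T := T) (hsym w₁ (by intro x; simp +contextual [hZ]))
  have m₂ := mem_localGroup (T := T) (hsym w₂ (by intro x; simp +contextual [hZ]))
  have m₃ := mem_localGroup (T := T) (hsym w₃ (by intro x; simp +contextual [hZ]))
  have m₄ := mem_localGroup (T := T) (hsym w₄ (by intro x; simp +contextual [hZ]))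
  have key : ∀ {a b c d : FreeMonoid ℕ},
      T.le (a * (of y * Z ^ T.N) * c) (b * (of y * Z ^ T.N) * d) →
      T.q Z ^ T.N * T.q c * T.q Z ^ T.N ∈ T.localGroup Z →
      T.q Z ^ T.N * T.q d * T.q Z ^ T.N ∈ T.localGroup Z →
      ∃ k ∈ T.localGroup Z, T.q (a * of y) * T.q Z ^ T.N ≤ T.q (b * of y) * k := by
    intro a b c d hle hc hd
    obtain ⟨l, hl, hcl, -⟩ := localGroup_inv hc
    refine ⟨_, localGroup_mul hd hl, ?_⟩
    refine le_of_eq_of_le (congrArg _ hcl.symm) ?_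
    have := mul_le_right l (mul_le_right (T.q Z ^ T.N) (q_le_iff.2 hle))
    simpa only [map_mul, map_pow, mul_assoc] using this
  obtain ⟨k, hk, g⟩ := key g m₁ m₂
  obtain ⟨l, hl, g'⟩ := key g' m₃ m₄
  have h2 : T.q (v * of y) * k ≤ T.q (u * of y) * T.q Z ^ T.N * (l * k) := by
    have := mul_le_right k g'
    rwa [mul_assoc, localGroup_left hk, mul_assoc, ← localGroup_left hl, mul_assoc, ← mul_assoc]
      at this
  -- Here `c ≤ q (v * y) * k ≤ c * (l * k)` for `c = q (u * y) * q Z ^ N`; the outer terms agree, so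
  -- the chain collapses.
  have h3 := mul_eq_of_le (localGroup_mul hl hk)
    (by rw [mul_assoc, pow_N_idem]) (g.trans h2)
  have h4 := le_antisymm g (h3 ▸ h2)
  obtain ⟨a, -, rfl⟩ := hk
  refine ⟨y, hy.1, hy.2, Z ^ T.N, Z ^ T.N * a * Z ^ T.N, ?_⟩
  simpa only [map_mul, map_pow, mul_assoc] using h4

/-- Evaluating the fresh letter at the left zero `zero 1 x` deletes the tail and leaves the value of
the prefix as the `M`-coordinate. -/
theorem Models.prefixTheory {T : OrdTheory} {M X : Type} [Monoid M] [Nonempty X]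
    (h : T.Models (Plus M X)) : T.prefixTheory.Models M := by
  intro u v huv η
  obtain ⟨y, hu, hv, w, w', h'⟩ := exists_eq_of_prefixTheory_eq huv
  let f : M →* Plus M X := ⟨⟨Plus.el, rfl⟩, fun _ _ => rfl⟩
  have hf : ∀ u : FreeMonoid ℕ, lift (fun x => f (η x)) u = .el (lift η u) := fun u =>
    DFunLike.congr_fun (comp_lift f η).symm u
  have := h _ _ h' (Function.update (fun x => f (η x)) y (.zero 1 (Classical.arbitrary X)))
  simp only [map_mul, lift_eval_of, lift_update_of_notMem _ hu, lift_update_of_notMem _ hv,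
    Function.update_self, hf, Plus.el_mul_zero, Plus.zero_mul, mul_one] at this
  exact (Plus.zero.inj this).1

end OrdTheory

/-! ### Contents, last new letters and the induction on the number of letters -/

namespace OrdTheory

open FreeMonoid

/-- The word `2 x 2 y 2`. -/
def pairWord (x y : ℕ) : FreeMonoid ℕ := of 2 * of x * of 2 * of y * of 2

theorem symbols_pairWord : (pairWord 0 1).symbols = {0, 1, 2} := by decide

theorem symbols_pairWord_swap : (pairWord 1 0).symbols = {0, 1, 2} := by decide

theorem pow_eq_self_of_left_zero {M : Type} [Monoid M] {a : M} (ha : ∀ m, a * m = a) {n : ℕ}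
    (hn : 0 < n) : a ^ n = a := by
  obtain ⟨n, rfl⟩ := Nat.exists_eq_succ_of_ne_zero hn.ne'
  rw [pow_succ', ha]

/-- A monoid has two distinct left zeros. -/
def HasTwoLeftZeros (M : Type) [Monoid M] : Prop :=
  ∃ a b : M, a ≠ b ∧ (∀ m, a * m = a) ∧ ∀ m, b * m = b

theorem hasTwoLeftZeros_plus (M X : Type) [Monoid M] [Nontrivial M] [Nonempty X] :
    HasTwoLeftZeros (Plus M X) := by
  obtain ⟨m, n, h⟩ := exists_pair_ne M
  let x := Classical.arbitrary X
  exact ⟨.zero m x, .zero n x, fun h' => h (Plus.zero.inj h').1, fun _ => rfl, fun _ => rfl⟩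

variable {T : OrdTheory} {M : Type} [Monoid M]

/-- Let `e` and `f` be the idempotents of the two pair words. Exchanging the letters `0` and `1`
turns `e ≤ f h` into `f ≤ e h'`, so `e ≤ f h e ≤ e h' h e`. The last element lies in the local group
at `e`, hence equals `e`, and `e = f h e` becomes an identity. Two left zeros refute it, since `e`
starts with `0` and `f` with `1` once `2` is sent to the identity. -/
theorem not_le_swap (hM : T.Models M) (hz : HasTwoLeftZeros M) {h : FreeMonoid ℕ}
    (hs : h.symbols ⊆ {0, 1, 2}) :
    ¬ T.q (pairWord 0 1) ^ T.N ≤ T.q (pairWord 1 0) ^ T.N * T.q h := by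
  intro hle
  let σ : ℕ → FreeMonoid ℕ := fun x => if x = 0 then of 1 else if x = 1 then of 0 else of x
  have hσ : ∀ x, σ x ≠ 1 := by
    intro x
    simp only [σ]
    split_ifs <;> exact of_ne_one _
  have hσs : (lift σ h).symbols ⊆ {0, 1, 2} := by
    refine symbols_lift_subset fun x hx => ?_
    have := hs hx
    simp only [Finset.mem_insert, Finset.mem_singleton] at this
    rcases this with rfl | rfl | rfl <;> decide
  have hswap : T.q (pairWord 1 0) ^ T.N ≤ T.q (pairWord 0 1) ^ T.N * T.q (lift σ h) := by
    simp only [← map_pow, ← map_mul] at hle ⊢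
    have := T.subst σ hσ (q_le_iff.1 hle)
    simp only [map_mul, map_pow] at this
    have h1 : lift σ (pairWord 0 1) = pairWord 1 0 := rfl
    have h2 : lift σ (pairWord 1 0) = pairWord 0 1 := rfl
    rw [h1, h2] at this
    exact q_le_iff.2 this
  set e := T.q (pairWord 0 1) ^ T.N with he
  set f := T.q (pairWord 1 0) ^ T.N
  have h1 : e ≤ f * T.q h * e := by
    have := mul_le_right e hle
    rwa [he, pow_N_idem] at this
  have h2 : f * T.q h * e ≤ e * T.q (lift σ h * h) * e := by
    have := mul_le_right (T.q h * e) hswap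
    simpa only [map_mul, mul_assoc] using this
  have hk := mem_localGroup (T := T) (Z := pairWord 0 1) (a := lift σ h * h) (by
    rw [symbols_mul, symbols_pairWord]
    exact Finset.union_subset hσs hs)
  have h3 := eq_of_le_localGroup hk (h1.trans h2)
  have h4 : T.q (pairWord 0 1 ^ T.N) = T.q (pairWord 1 0 ^ T.N * h * pairWord 0 1 ^ T.N) := by
    simp only [map_mul, map_pow]
    exact le_antisymm h1 (h2.trans h3.le)
  obtain ⟨a, b, hab, ha, hb⟩ := hz
  have h5 := hM _ _ h4 (fun x => if x = 0 then a else if x = 1 then b else 1)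
  simp only [map_mul, map_pow, pairWord, lift_eval_of] at h5
  simp [ha, hb, pow_eq_self_of_left_zero, T.N_pos] at h5
  exact hab h5

theorem mul_lift_eq_self {Q : Type} [Monoid Q] {g : ℕ → Q} {c : Q} {u : FreeMonoid ℕ}
    (h : ∀ x ∈ u.symbols, c * g x = c) : c * lift g u = c := by
  induction u using FreeMonoid.inductionOn' with
  | one => simp
  | of_mul x u ih =>
    rw [map_mul, lift_eval_of, ← mul_assoc, h x (by simp), ih fun y hy => h y (by simp_all)]

/-- The elements `z` and `e` form a semilattice with identity `z` and zero `e`, so a single factor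
`e` decides the product. -/
theorem mul_lift_eq {Q : Type} [Monoid Q] {g : ℕ → Q} {z e : Q} (hz : z * z = z) (hze : z * e = e)
    (hez : e * z = e) (he : e * e = e) {u : FreeMonoid ℕ} {t : ℕ} (ht : t ∈ u.symbols)
    (hte : g t = e) (h : ∀ x ∈ u.symbols, g x = e ∨ g x = z) : z * lift g u = e := by
  induction u using FreeMonoid.inductionOn' with
  | one => simp at ht
  | of_mul x u ih =>
    have hu : ∀ y ∈ u.symbols, g y = e ∨ g y = z := fun y hy => h y (by simp_all)
    have key : e * lift g u = e :=
      mul_lift_eq_self fun y hy => by rcases hu y hy with h | h <;> rw [h] <;> assumption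
    rw [map_mul, lift_eval_of, ← mul_assoc]
    rcases h x (by simp) with hx | hx
    · rw [hx, hze, key]
    · rw [hx, hz]
      by_cases htu : t ∈ u.symbols
      · exact ih htu hu
      · have : t = x := by
          rw [symbols_mul, Finset.mem_union] at ht
          simpa using ht.resolve_right htu
        subst this
        rw [hte] at hx
        rwa [← hx]

section

variable (T)

theorem z_mul_pair (x y : ℕ) :
    T.q (of 2) ^ T.N * T.q (pairWord x y) ^ T.N = T.q (pairWord x y) ^ T.N := by
  have h : T.q (of 2) ^ T.N * T.q (pairWord x y) = T.q (pairWord x y) := by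
    simp only [pairWord, map_mul, ← mul_assoc, pow_N_mul]
  rw [← mul_pow_pred (T.q (pairWord x y)), ← mul_assoc, h]

theorem pair_mul_z (x y : ℕ) :
    T.q (pairWord x y) ^ T.N * T.q (of 2) ^ T.N = T.q (pairWord x y) ^ T.N := by
  have h : T.q (pairWord x y) * T.q (of 2) ^ T.N = T.q (pairWord x y) := by
    simp only [pairWord, map_mul, mul_assoc, mul_pow_N]
  rw [← pow_pred_mul (T.q (pairWord x y)), mul_assoc, h]

/-- The substitution which sends `x` to `(2 0 2 1 2)^N`, `y` to `(2 1 2 0 2)^N`, and all other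
letters to `2^N`. -/
def pairSubst (x y : ℕ) (t : ℕ) : FreeMonoid ℕ :=
  if t = x then pairWord 0 1 ^ T.N else if t = y then pairWord 1 0 ^ T.N else of 2 ^ T.N

theorem pow_N_ne_one {u : FreeMonoid ℕ} (h : u ≠ 1) : u ^ T.N ≠ 1 := by
  obtain ⟨n, hn⟩ := Nat.exists_eq_succ_of_ne_zero T.N_pos.ne'
  rw [hn, pow_succ']
  exact mul_ne_one_left _ h

theorem pairWord_ne_one (x y : ℕ) : pairWord x y ≠ 1 := by
  intro h
  have := congrArg FreeMonoid.length h
  simp [pairWord] at this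

theorem pairSubst_ne_one (x y t : ℕ) : T.pairSubst x y t ≠ 1 := by
  rw [pairSubst]
  split_ifs
  · exact T.pow_N_ne_one (pairWord_ne_one _ _)
  · exact T.pow_N_ne_one (pairWord_ne_one _ _)
  · exact T.pow_N_ne_one (of_ne_one _)

theorem symbols_lift_pairSubst (x y : ℕ) (u : FreeMonoid ℕ) :
    (lift (T.pairSubst x y) u).symbols ⊆ {0, 1, 2} := by
  refine symbols_lift_subset fun t _ => ?_
  rw [pairSubst]
  split_ifs
  · rw [symbols_pow _ T.N_pos, symbols_pairWord]
  · rw [symbols_pow _ T.N_pos, symbols_pairWord_swap]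
  · rw [symbols_pow _ T.N_pos, symbols_of]
    decide

theorem q_lift (σ : ℕ → FreeMonoid ℕ) (u : FreeMonoid ℕ) :
    T.q (lift σ u) = lift (fun t => T.q (σ t)) u :=
  DFunLike.congr_fun (comp_lift T.q σ) u

variable {T}

theorem z_mul_lift_left {x y : ℕ} {u : FreeMonoid ℕ} (hx : x ∈ u.symbols) (hy : y ∉ u.symbols) :
    T.q (of 2) ^ T.N * T.q (lift (T.pairSubst x y) u) = T.q (pairWord 0 1) ^ T.N := by
  rw [q_lift]
  refine mul_lift_eq (pow_N_idem _) (z_mul_pair ..) (pair_mul_z ..) (pow_N_idem _) hx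
    (by simp [-Con.coe_mk', pairSubst]) fun t ht => ?_
  have : t ≠ y := by rintro rfl; exact hy ht
  by_cases h : t = x
  · simp [-Con.coe_mk', pairSubst, h]
  · simp [-Con.coe_mk', pairSubst, h, this]

theorem z_mul_lift_right {x y : ℕ} {u : FreeMonoid ℕ} (hx : x ∉ u.symbols) (hy : y ∈ u.symbols) :
    T.q (of 2) ^ T.N * T.q (lift (T.pairSubst x y) u) = T.q (pairWord 1 0) ^ T.N := by
  have hyx : y ≠ x := by rintro rfl; exact hx hy
  rw [q_lift]
  refine mul_lift_eq (pow_N_idem _) (z_mul_pair ..) (pair_mul_z ..) (pow_N_idem _) hy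
    (by simp [-Con.coe_mk', pairSubst, hyx]) fun t ht => ?_
  have : t ≠ x := by rintro rfl; exact hx ht
  by_cases h : t = y
  · simp [-Con.coe_mk', pairSubst, h, hyx]
  · simp [-Con.coe_mk', pairSubst, h, this]

theorem z_mul_lift_none {x y : ℕ} {u : FreeMonoid ℕ} (hx : x ∉ u.symbols) (hy : y ∉ u.symbols) :
    T.q (of 2) ^ T.N * T.q (lift (T.pairSubst x y) u) = T.q (of 2) ^ T.N := by
  rw [q_lift]
  refine mul_lift_eq_self fun t ht => ?_
  have h : t ≠ x := by rintro rfl; exact hx ht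
  have h' : t ≠ y := by rintro rfl; exact hy ht
  simp [-Con.coe_mk', pairSubst, h, h', pow_N_idem]

end

/-- An inequality `e a ≤ f b` between words in the letters `0`, `1`, `2` is impossible. -/
theorem not_mul_le_mul (hM : T.Models M) (hz : HasTwoLeftZeros M) {a b : FreeMonoid ℕ}
    (ha : a.symbols ⊆ {0, 1, 2}) (hb : b.symbols ⊆ {0, 1, 2}) :
    ¬ T.q (pairWord 0 1) ^ T.N * T.q a ≤ T.q (pairWord 1 0) ^ T.N * T.q b := by
  intro h
  have hk := mem_localGroup (T := T) (Z := pairWord 0 1) (ha.trans symbols_pairWord.ge)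
  obtain ⟨l, ⟨c, hc, rfl⟩, hl, -⟩ := localGroup_inv hk
  have h2 := mul_le_right (T.q (pairWord 0 1) ^ T.N *
    (T.q (pairWord 0 1) ^ T.N * T.q c * T.q (pairWord 0 1) ^ T.N)) h
  rw [← mul_assoc (_ * T.q a), hl] at h2
  refine not_le_swap hM hz (h := b * (pairWord 0 1 ^ T.N *
    (pairWord 0 1 ^ T.N * c * pairWord 0 1 ^ T.N))) ?_
    (by simpa only [map_mul, map_pow, mul_assoc] using h2)
  have hp := symbols_pow_subset (pairWord 0 1) T.N
  rw [symbols_pairWord] at hp hc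
  simp only [symbols_mul, Finset.union_subset_iff]
  exact ⟨hb, hp, ⟨hp, hc⟩, hp⟩

/-- If `t` occurs on one side only, `pairSubst` with the fresh partner `s` makes that side `e` or
`f` and the other side `2 ^ N`. Multiplying by the opposite idempotent gives an inequality excluded
by `not_mul_le_mul`. -/
theorem symbols_eq_of_le (hM : T.Models M) (hz : HasTwoLeftZeros M) {u v : FreeMonoid ℕ}
    (h : T.le u v) : u.symbols = v.symbols := by
  have key : ∀ x y : ℕ, T.q (of 2) ^ T.N * T.q (lift (T.pairSubst x y) u) ≤
      T.q (of 2) ^ T.N * T.q (lift (T.pairSubst x y) v) := fun x y =>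
    mul_le_left _ (q_le_iff.2 (T.subst _ (T.pairSubst_ne_one x y) h))
  obtain ⟨s, hs⟩ := exists_fresh (u.symbols ∪ v.symbols)
  rw [Finset.notMem_union] at hs
  refine Finset.Subset.antisymm (fun t ht => ?_) (fun t ht => ?_) <;> by_contra ht'
  · have h1 := key t s
    rw [z_mul_lift_left ht hs.1, z_mul_lift_none ht' hs.2] at h1
    have h2 := mul_le_right (T.q (pairWord 1 0) ^ T.N) h1
    rw [z_mul_pair] at h2
    refine not_mul_le_mul hM hz (a := pairWord 1 0 ^ T.N) (b := 1) ?_ (by simp)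
      (by simpa only [map_pow, map_one, mul_one] using h2)
    rw [symbols_pow _ T.N_pos, symbols_pairWord_swap]
  · have h1 := key s t
    rw [z_mul_lift_right hs.2 ht, z_mul_lift_none hs.1 ht'] at h1
    have h2 := mul_le_right (T.q (pairWord 0 1) ^ T.N) h1
    rw [z_mul_pair] at h2
    refine not_mul_le_mul hM hz (a := 1) (b := pairWord 0 1 ^ T.N) (by simp) ?_
      (by simpa only [map_pow, map_one, mul_one] using h2)
    rw [symbols_pow _ T.N_pos, symbols_pairWord]

/-- If `y` occurred in `v`, `pairSubst x y` would turn the prefix `u`, which has `x` but not `y`,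
into `e`, and the prefix `v`, which has `y` but not `x`, into `f`, contrary to `not_mul_le_mul`. -/
theorem last_new_letter_eq (hM : T.Models M) (hz : HasTwoLeftZeros M) {u v w w' : FreeMonoid ℕ}
    {x y : ℕ} (h : T.le (u * of y * w) (v * of x * w')) (hyu : y ∉ u.symbols)
    (hxv : x ∉ v.symbols) (hxu : x ∈ u.symbols) : y ∉ v.symbols := by
  intro hyv
  have h1 := mul_le_left (T.q (of 2) ^ T.N)
    (q_le_iff.2 (T.subst _ (T.pairSubst_ne_one x y) h))
  rw [mul_assoc, mul_assoc, map_mul, map_mul (lift _) v, map_mul, map_mul T.q (lift _ v),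
    ← mul_assoc, ← mul_assoc, z_mul_lift_left hxu hyu, z_mul_lift_right hxv hyv] at h1
  exact not_mul_le_mul hM hz (T.symbols_lift_pairSubst ..) (T.symbols_lift_pairSubst ..) h1

theorem eq_one_of_symbols_eq_empty {u : FreeMonoid ℕ} (h : u.symbols = ∅) : u = 1 := by
  cases u using FreeMonoid.casesOn with
  | one => rfl
  | of_mul x u => simp at h

theorem exists_last_new_letter (u : FreeMonoid ℕ) (hu : u ≠ 1) :
    ∃ u' y w, u = u' * of y * w ∧ y ∉ u'.symbols ∧ u.symbols = insert y u'.symbols := by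
  -- Induction on words removes the first letter; reversal makes it the last one.
  have key : ∀ v : FreeMonoid ℕ, v.reverse ≠ 1 → ∃ u' y w, v.reverse = u' * of y * w ∧
      y ∉ u'.symbols ∧ v.reverse.symbols = insert y u'.symbols := by
    intro v
    induction v using FreeMonoid.inductionOn' with
    | one => exact fun h => (h rfl).elim
    | of_mul x v ih =>
      intro _
      rw [reverse_mul, reverse_of]
      by_cases hx : x ∈ v.reverse.symbols
      · obtain ⟨u', y, w, h, hy, hs⟩ := ih (by intro h; simp [h] at hx)
        refine ⟨u', y, w * of x, by rw [h]; simp only [mul_assoc], hy, ?_⟩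
        rw [symbols_mul, symbols_of, ← hs, Finset.union_eq_left]
        simpa using hx
      · exact ⟨v.reverse, x, 1, by simp, hx, by rw [symbols_mul, symbols_of, Finset.union_comm]; rfl⟩
  simpa only [reverse_reverse] using key u.reverse (by rwa [reverse_reverse])

/-- In the local group at `u`, the elements `g` of `u` and `k` of `v` satisfy `g ≤ k`; then `1 ≤ k *
g⁻¹` forces `k = g`. -/
theorem q_eq_of_le {u v : FreeMonoid ℕ} (h : T.le u v) (hs : v.symbols ⊆ u.symbols) :
    T.q u = T.q (u ^ T.N * v * u ^ T.N) := by
  have hg := mem_localGroup (T := T) (subset_refl u.symbols)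
  have hk := mem_localGroup (T := T) hs
  obtain ⟨l, hl, hgl, hlg⟩ := localGroup_inv hg
  have h1 := mul_le_right l (mul_le_right (T.q u ^ T.N) (mul_le_left (T.q u ^ T.N) (q_le_iff.2 h)))
  rw [hgl] at h1
  have h2 := eq_of_le_localGroup (localGroup_mul hk hl) h1
  have h3 := congrArg (· * (T.q u ^ T.N * T.q u * T.q u ^ T.N)) h2
  beta_reduce at h3
  rw [mul_assoc, hlg, localGroup_right hk, localGroup_left hg, pow_N_mul, mul_pow_N] at h3
  simpa only [map_mul, map_pow] using h3.symm

/-- Whenever a theory is modelled by `M₁`, its inequalities between words in at most `k` letters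
are identities of `M`. -/
def Determines (M₁ M : Type) [Monoid M₁] [Monoid M] (k : ℕ) : Prop :=
  ∀ T : OrdTheory, T.Models M₁ → ∀ u v, T.le u v → (u.symbols ∪ v.symbols).card ≤ k →
    ∀ η : ℕ → M, lift η u = lift η v

variable {M₁ : Type} [Monoid M₁] {k : ℕ}

theorem le_reverse {u v : FreeMonoid ℕ} (h : T.le u v) : T.op.le u.reverse v.reverse := by
  simpa only [op, reverse_reverse] using h

theorem Determines.op (h : Determines M₁ M k) : Determines M₁ᵐᵒᵖ Mᵐᵒᵖ k := by
  intro T hT u v huv hc η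
  apply MulOpposite.unop_injective
  rw [map_lift_reverse MulOpposite.unop rfl (fun _ _ => rfl),
    map_lift_reverse MulOpposite.unop rfl (fun _ _ => rfl)]
  refine h T.op ?_ _ _ (le_reverse huv) (by rwa [symbols_reverse, symbols_reverse]) _
  exact hT.op MulOpposite.op rfl (fun _ _ => rfl) MulOpposite.op_injective

/-- The prefixes before the common last new letter agree in `M` by the hypothesis on `k` letters,
and the rest of `u` is cancelled by `exists_mul_eq`. -/
theorem exists_lift_mul_eq [Nontrivial M₁] (h₁ : T.Models (Plus M₁ Unit)) (hM : T.Models M)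
    (hd : Determines M₁ M k) {u v : FreeMonoid ℕ} (h : T.le u v)
    (hc : (u.symbols ∪ v.symbols).card ≤ k + 1) (η : ℕ → M) :
    ∃ b, lift η v = lift η u * b := by
  have hz := hasTwoLeftZeros_plus M₁ Unit
  have hs := symbols_eq_of_le h₁ hz h
  by_cases hu : u = 1
  · subst hu
    exact ⟨lift η v, by simp⟩
  have hv : v ≠ 1 := by
    rintro rfl
    exact hu (eq_one_of_symbols_eq_empty hs)
  obtain ⟨u', y, w, rfl, hy, hus⟩ := exists_last_new_letter u hu
  obtain ⟨v', x, w', rfl, hx, hvs⟩ := exists_last_new_letter v hv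
  obtain rfl : y = x := by
    by_contra hne
    rw [hus, hvs] at hs
    have hxu : x ∈ u'.symbols := by
      have : x ∈ insert y u'.symbols := hs ▸ Finset.mem_insert_self _ _
      exact (Finset.mem_insert.1 this).resolve_left (Ne.symm hne)
    have hyv : y ∈ v'.symbols := by
      have : y ∈ insert x v'.symbols := hs ▸ Finset.mem_insert_self _ _
      exact (Finset.mem_insert.1 this).resolve_left hne
    exact last_new_letter_eq h₁ hz h hy hx hxu hyv
  -- Both prefixes avoid `y`, so at most `k` letters are left.
  have he : lift η u' = lift η v' := by
    refine hd T.prefixTheory h₁.prefixTheory u' v' ⟨y, hy, hx, w, w', h⟩ ?_ η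
    have hn : y ∉ u'.symbols ∪ v'.symbols := by simp_all
    have : insert y (u'.symbols ∪ v'.symbols) =
        (u' * of y * w).symbols ∪ (v' * of y * w').symbols := by
      rw [hus, hvs]
      ext t
      simp only [Finset.mem_insert, Finset.mem_union]
      tauto
    rw [← this, Finset.card_insert_of_notMem hn] at hc
    omega
  obtain ⟨b, hb⟩ := exists_mul_eq (T := T) (u' * of y) w (by
    have : (u' * of y).symbols = (u' * of y * w).symbols := by
      rw [hus, symbols_mul, symbols_of, Finset.union_comm]; rfl
    rw [this, symbols_mul]
    exact Finset.subset_union_right)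
  obtain ⟨b, rfl⟩ := T.q_surjective b
  have hb' := hM (u' * of y * w * b) (u' * of y) (by simpa only [map_mul] using hb) η
  refine ⟨lift η b * lift η w', ?_⟩
  rw [← mul_assoc, ← map_mul, hb']
  simp only [map_mul, he]

theorem exists_mul_lift_eq [Nontrivial M₁] (h₁ : T.Models (Minus M₁ Unit)) (hM : T.Models M)
    (hd : Determines M₁ M k) {u v : FreeMonoid ℕ} (h : T.le u v)
    (hc : (u.symbols ∪ v.symbols).card ≤ k + 1) (η : ℕ → M) :
    ∃ b, lift η v = b * lift η u := by
  obtain ⟨b, hb⟩ := exists_lift_mul_eq h₁.plus_of_minus hM.op_op hd.op (le_reverse h)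
    (by rwa [symbols_reverse, symbols_reverse]) (fun x => MulOpposite.op (η x))
  rw [← map_lift_reverse MulOpposite.op rfl (fun _ _ => rfl),
    ← map_lift_reverse MulOpposite.op rfl (fun _ _ => rfl)] at hb
  exact ⟨b.unop, congrArg MulOpposite.unop hb⟩

/-- The factor `M` makes identities of `T` available in `M`; the other two factors show that `v` is
a right and a left multiple of `u` in `M`. Hence `u ^ N` is neutral for `v` on both sides, and
`q_eq_of_le` yields `u = u ^ N v u ^ N = v`. -/
theorem Determines.succ [Nontrivial M₁] (hd : Determines M₁ M k) :
    Determines (M × Plus M₁ Unit × Minus M₁ Unit) M (k + 1) := by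
  intro T hT u v h hc η
  have hM : T.Models M := hT.of_surjective (MonoidHom.fst _ _) Prod.fst_surjective
  have hPM := hT.of_surjective (MonoidHom.snd _ _) Prod.snd_surjective
  have hP := hPM.of_surjective (MonoidHom.fst _ _) Prod.fst_surjective
  have hMi := hPM.of_surjective (MonoidHom.snd _ _) Prod.snd_surjective
  have hs := symbols_eq_of_le hP (hasTwoLeftZeros_plus _ _) h
  obtain ⟨b, hb⟩ := exists_lift_mul_eq hP hM hd h hc η
  obtain ⟨c, hcv⟩ := exists_mul_lift_eq hMi hM hd h hc η
  have h1 := hM _ _ (q_eq_of_le h hs.ge) η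
  have h2 := hM (u ^ (T.N + 1)) u (by rw [map_pow, pow_N_succ]) η
  simp only [map_mul, map_pow] at h1 h2
  have h3 : lift η u ^ T.N * lift η v = lift η v := by rw [hb, ← mul_assoc, ← pow_succ, h2]
  have h4 : lift η v * lift η u ^ T.N = lift η v := by rw [hcv, mul_assoc, ← pow_succ', h2]
  rw [h1, h3, h4]

theorem determines_zero : Determines M₁ M 0 := by
  intro T _ u v _ hc η
  rw [Nat.le_zero, Finset.card_eq_zero, Finset.union_eq_empty] at hc
  rw [eq_one_of_symbols_eq_empty hc.1, eq_one_of_symbols_eq_empty hc.2]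

end OrdTheory

/-! ### Pseudovarieties, and `CR` and `A` in terms of powers -/

namespace FinSgp

/-- Bundle a finite semigroup. -/
abbrev of (S : Type) [Semigroup S] [Finite S] [Nonempty S] : FinSgp where
  carrier := S
  semigroup := inferInstance
  finite := inferInstance
  nonempty := inferInstance

instance {S : Type} [Finite S] : Finite (WithOne S) := inferInstanceAs (Finite (Option S))

namespace IsPseudovariety

variable {V : Set FinSgp}

/-- A pseudovariety is closed under division. -/
theorem mem_of_rel (hV : IsPseudovariety V) {S T : FinSgp} (hT : T ∈ V) (r : S → T → Prop)
    (total : ∀ s, ∃ t, r s t) (mul : ∀ s s' t t', r s t → r s' t' → r (s * s') (t * t'))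
    (inj : ∀ s s' t, r s t → r s' t → s = s') : S ∈ V := by
  let D : Subsemigroup (S × T) := ⟨{p | r p.1 p.2}, fun {p q} hp hq => mul _ _ _ _ hp hq⟩
  have : Nonempty D := by
    obtain ⟨t, ht⟩ := total (Classical.arbitrary S)
    exact ⟨⟨(_, t), ht⟩⟩
  have hD : of D ∈ V := hV.sub_mem hT ((MulHom.snd S T).comp (MulMemClass.subtype D)) (by
    rintro ⟨⟨s, t⟩, h⟩ ⟨⟨s', t'⟩, h'⟩ (rfl : t = t')
    obtain rfl := inj _ _ _ h h'
    rfl)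
  refine hV.image_mem hD ((MulHom.fst S T).comp (MulMemClass.subtype D)) fun s => ?_
  obtain ⟨t, ht⟩ := total s
  exact ⟨⟨(s, t), ht⟩, rfl⟩

theorem of_injective (hV : IsPseudovariety V) {S T : Type} [Semigroup S] [Finite S] [Nonempty S]
    [Semigroup T] [Finite T] [Nonempty T] (hT : of T ∈ V) (f : S →ₙ* T)
    (hf : Function.Injective f) : of S ∈ V :=
  hV.sub_mem (S := of S) hT f hf

theorem of_surjective (hV : IsPseudovariety V) {S T : Type} [Semigroup S] [Finite S] [Nonempty S]
    [Semigroup T] [Finite T] [Nonempty T] (hS : of S ∈ V) (f : S →ₙ* T)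
    (hf : Function.Surjective f) : of T ∈ V :=
  hV.image_mem (T := of T) hS f hf

theorem of_prod (hV : IsPseudovariety V) {S T : Type} [Semigroup S] [Finite S] [Nonempty S]
    [Semigroup T] [Finite T] [Nonempty T] (hS : of S ∈ V) (hT : of T ∈ V) : of (S × T) ∈ V :=
  hV.prod_mem hS hT

theorem of_pi (hV : IsPseudovariety V) {S : Type} [Semigroup S] [Finite S] [Nonempty S]
    (hS : of S ∈ V) (ι : Type) [Finite ι] : of (ι → S) ∈ V := by
  suffices h : ∀ _ : Finite ι, of (ι → S) ∈ V from h inferInstance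
  refine Finite.induction_empty_option (P := fun ι => ∀ _ : Finite ι, of (ι → S) ∈ V)
    ?_ ?_ ?_ ι
  · intro α β e h _
    have := Finite.of_equiv β e.symm
    refine hV.of_injective (h this) ⟨fun f => f ∘ e, fun _ _ => rfl⟩ fun f g hfg => ?_
    funext b
    simpa using congrFun hfg (e.symm b)
  · intro _
    refine hV.of_surjective hV.trivial_mem ⟨fun _ => PEmpty.elim, fun _ _ => ?_⟩ fun f => ⟨⟨⟩, ?_⟩
    · exact funext fun x => x.elim
    · exact funext fun x => x.elim
  · intro α _ h _
    refine hV.of_injective (hV.of_prod hS (h inferInstance))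
      ⟨fun f => (f none, fun a => f (some a)), fun _ _ => rfl⟩ fun f g hfg => ?_
    funext a
    cases a with
    | none => exact congrArg Prod.fst hfg
    | some a => exact congrFun (congrArg Prod.snd hfg) a

end IsPseudovariety

theorem isPseudovariety_generated (K : Set FinSgp) : IsPseudovariety (generated K) where
  image_mem hS f hf V hV hK := hV.image_mem (hS V hV hK) f hf
  sub_mem hT f hf V hV hK := hV.sub_mem (hT V hV hK) f hf
  trivial_mem _ hV _ := hV.trivial_mem
  prod_mem hS hT V hV hK := hV.prod_mem (hS V hV hK) (hT V hV hK)

theorem isPseudovariety_inter {V W : Set FinSgp} (hV : IsPseudovariety V)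
    (hW : IsPseudovariety W) : IsPseudovariety (V ∩ W) where
  image_mem hS f hf := ⟨hV.image_mem hS.1 f hf, hW.image_mem hS.2 f hf⟩
  sub_mem hT f hf := ⟨hV.sub_mem hT.1 f hf, hW.sub_mem hT.2 f hf⟩
  trivial_mem := ⟨hV.trivial_mem, hW.trivial_mem⟩
  prod_mem hS hT := ⟨hV.prod_mem hS.1 hT.1, hW.prod_mem hS.2 hT.2⟩

section powers

theorem pow_mul_eq_of_idem {M : Type} [Monoid M] {x : M} {n : ℕ} (h : x ^ n * x ^ n = x ^ n) :
    ∀ {m : ℕ}, 0 < m → x ^ (n * m) = x ^ n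
  | 1, _ => by rw [mul_one]
  | m + 2, _ => by
    rw [show n * (m + 2) = n * (m + 1) + n by ring, pow_add,
      pow_mul_eq_of_idem h (Nat.succ_pos m), h]

theorem exists_pow_idem {M : Type} [Monoid M] [Finite M] (x : M) :
    ∃ n, 0 < n ∧ x ^ n * x ^ n = x ^ n := by
  obtain ⟨i, j, hij, h⟩ := Finite.exists_ne_map_eq_of_infinite (fun n : ℕ => x ^ n)
  wlog hlt : i < j generalizing i j
  · exact this j i hij.symm h.symm (by omega)
  obtain ⟨p, rfl⟩ := Nat.exists_eq_add_of_lt hlt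
  have h1 : ∀ k, x ^ (i + k + (p + 1)) = x ^ (i + k) := by
    intro k
    have h : x ^ i = x ^ (i + p + 1) := h
    rw [show i + k + (p + 1) = (i + p + 1) + k by ring, pow_add, ← h, ← pow_add]
  have h2 : ∀ m k, x ^ (i + k + (p + 1) * m) = x ^ (i + k) := by
    intro m
    induction m with
    | zero => simp
    | succ m ih =>
      intro k
      rw [mul_add_one, ← add_assoc, add_assoc i k, h1, ← add_assoc, ih]
  -- This exponent is a multiple of the period `p + 1` and not smaller than the index `i`.
  refine ⟨(p + 1) * (i + 1), by positivity, ?_⟩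
  obtain ⟨k, hk⟩ : ∃ k, (p + 1) * (i + 1) = i + k :=
    Nat.exists_eq_add_of_le (by nlinarith [Nat.zero_le (p * i)])
  have := h2 (i + 1) k
  rw [← hk] at this
  rwa [← pow_add]

theorem exists_uniform_pow {M : Type} [Finite M] {P : M → ℕ → Prop}
    (h : ∀ x, ∃ n, 0 < n ∧ ∀ m, 0 < m → P x (n * m)) : ∃ n, 0 < n ∧ ∀ x, P x n := by
  have := Fintype.ofFinite M
  classical
  choose n hn hP using h
  refine ⟨∏ x, n x, Finset.prod_pos fun x _ => hn x, fun x => ?_⟩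
  rw [← Finset.mul_prod_erase _ _ (Finset.mem_univ x)]
  exact hP x _ (Finset.prod_pos fun x _ => hn x)

variable {S : Type} [Semigroup S]

theorem exists_coe_pow (x : S) : ∀ {n : ℕ}, 0 < n → ∃ t : S, (x : WithOne S) ^ n = t
  | 1, _ => ⟨x, pow_one _⟩
  | n + 2, _ => by
    obtain ⟨t, ht⟩ := exists_coe_pow x (Nat.succ_pos n)
    exact ⟨t * x, by rw [pow_succ, ht, WithOne.coe_mul]⟩

theorem coe_pow_mem {H : Subsemigroup S} {x : S} (hx : x ∈ H) :
    ∀ {n : ℕ}, 0 < n → ∀ {t : S}, (x : WithOne S) ^ n = t → t ∈ H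
  | 1, _, t, ht => by
    rw [pow_one, WithOne.coe_inj] at ht
    exact ht ▸ hx
  | n + 2, _, t, ht => by
    obtain ⟨s, hs⟩ := exists_coe_pow x (Nat.succ_pos n)
    rw [pow_succ, hs, ← WithOne.coe_mul, WithOne.coe_inj] at ht
    exact ht ▸ H.mul_mem (coe_pow_mem hx (Nat.succ_pos n) hs) hx

/-- The powers of an element beyond an idempotent power form a group. -/
theorem exists_isGrp_of_pow_idem (x : S) {n : ℕ} (hn : 0 < n)
    (h : (x : WithOne S) ^ n * (x : WithOne S) ^ n = (x : WithOne S) ^ n) :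
    ∃ H : Subsemigroup S, IsGrp H ∧ ∀ k (t : S), (x : WithOne S) ^ (n + k) = t → t ∈ H := by
  let H : Subsemigroup S := ⟨{t | ∃ k, (x : WithOne S) ^ (n + k) = t}, by
    rintro a b ⟨k, hk⟩ ⟨l, hl⟩
    refine ⟨k + l, ?_⟩
    rw [WithOne.coe_mul, ← hk, ← hl, ← pow_add, show n + k + (n + l) = n + n + (k + l) by ring,
      pow_add, pow_add _ (n + n), pow_add _ n n, h]⟩
  obtain ⟨e, he⟩ := exists_coe_pow x hn
  have hmul : ∀ k, (x : WithOne S) ^ n * (x : WithOne S) ^ (n + k) = (x : WithOne S) ^ (n + k) := by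
    intro k
    rw [pow_add, ← mul_assoc, h]
  refine ⟨H, ⟨⟨e, 0, he⟩, ?_, ?_⟩, fun k t ht => ⟨k, ht⟩⟩
  · rintro ⟨t, k, hk⟩
    constructor <;> refine Subtype.ext (WithOne.coe_injective ?_) <;>
      change ((_ * _ : S) : WithOne S) = _ <;> rw [WithOne.coe_mul, ← he, ← hk]
    · exact hmul k
    · rw [← pow_add, add_comm, pow_add, hmul]
  · rintro ⟨t, k, hk⟩
    -- The inverse of `x ^ (n + k)`: the two exponents add up to `n * (k + 2)`.
    obtain ⟨s, hs⟩ := exists_coe_pow x (n := n + (n - 1) * k) (by omega)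
    have key : (x : WithOne S) ^ (n + k + (n + (n - 1) * k)) = x ^ n := by
      obtain ⟨m, rfl⟩ := Nat.exists_eq_succ_of_ne_zero hn.ne'
      rw [Nat.succ_eq_add_one, Nat.add_sub_cancel,
        show m + 1 + k + (m + 1 + m * k) = (m + 1) * (k + 2) by ring]
      exact pow_mul_eq_of_idem h (by omega)
    refine ⟨⟨s, _, hs⟩, ?_, ?_⟩ <;> refine Subtype.ext (WithOne.coe_injective ?_) <;>
      change ((_ * _ : S) : WithOne S) = _ <;> rw [WithOne.coe_mul, ← he, ← hk, ← hs, ← pow_add]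
    · rw [add_comm, key]
    · rw [key]

theorem eq_one_of_idem {H : Subsemigroup S} {e : H} (he : ∀ x, e * x = x ∧ x * e = x)
    (hinv : ∀ x, ∃ y, y * x = e ∧ x * y = e) {t : H} (ht : t * t = t) : t = e := by
  obtain ⟨y, hy, -⟩ := hinv t
  rw [← (he t).1, ← hy, mul_assoc, ht]

theorem exists_coe_pow_eq_one {H : Subsemigroup S} {e : H} (he : ∀ x, e * x = x ∧ x * e = x)
    (hinv : ∀ x, ∃ y, y * x = e ∧ x * y = e) {x : S} (hx : x ∈ H) {n : ℕ} (hn : 0 < n)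
    (h : (x : WithOne S) ^ n * (x : WithOne S) ^ n = (x : WithOne S) ^ n) :
    (x : WithOne S) ^ n = (e : S) := by
  obtain ⟨t, ht⟩ := exists_coe_pow x hn
  have htH := coe_pow_mem hx hn ht
  rw [ht, ← WithOne.coe_mul, WithOne.coe_inj] at h
  rw [ht, ← eq_one_of_idem he hinv (t := ⟨t, htH⟩) (Subtype.ext h)]

end powers

/-- Unlike the definition by subgroups, the equational form passes directly to images, subsemigroups
and products. `WithOne S` serves to have powers at hand. -/
theorem mem_CR_iff {S : FinSgp} :
    S ∈ CR ↔ ∀ x : S, ∃ n, 0 < n ∧ (x : WithOne S) ^ (n + 1) = x := by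
  constructor
  · intro hS x
    obtain ⟨H, hx, e, he, hinv⟩ := hS x
    obtain ⟨n, hn, hi⟩ := exists_pow_idem (x : WithOne S)
    refine ⟨n, hn, ?_⟩
    rw [pow_succ, exists_coe_pow_eq_one he hinv hx hn hi, ← WithOne.coe_mul]
    exact congrArg _ (congrArg Subtype.val (he ⟨x, hx⟩).1)
  · intro h x
    obtain ⟨n, hn, hx⟩ := h x
    obtain ⟨H, hH, hm⟩ := exists_isGrp_of_pow_idem x hn (by
      obtain ⟨m, rfl⟩ := Nat.exists_eq_succ_of_ne_zero hn.ne'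
      rw [← pow_add, show m.succ + m.succ = (m.succ + 1) + m by omega, pow_add, hx, ← pow_succ'])
    exact ⟨H, hm 1 x hx, hH⟩

theorem mem_A_iff {S : FinSgp} :
    S ∈ A ↔ ∀ x : S, ∃ n, 0 < n ∧ (x : WithOne S) ^ (n + 1) = (x : WithOne S) ^ n := by
  constructor
  · intro hS x
    obtain ⟨n, hn, hi⟩ := exists_pow_idem (x : WithOne S)
    obtain ⟨H, hH, hm⟩ := exists_isGrp_of_pow_idem x hn hi
    obtain ⟨s, hs⟩ := exists_coe_pow x hn
    obtain ⟨t, ht⟩ := exists_coe_pow x (Nat.succ_pos n)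
    refine ⟨n, hn, ?_⟩
    rw [hs, ht, hS H hH t (hm 1 t ht) s (hm 0 s hs)]
  · rintro h H ⟨e, he, hinv⟩
    have key : ∀ x ∈ H, x = e := by
      intro x hx
      obtain ⟨n, hn, hxn⟩ := h x
      obtain ⟨t, ht⟩ := exists_coe_pow x hn
      have htH := coe_pow_mem hx hn ht
      obtain ⟨y, hy, -⟩ := hinv ⟨t, htH⟩
      rw [pow_succ, ht, ← WithOne.coe_mul, WithOne.coe_inj] at hxn
      have h2 : (⟨t, htH⟩ : H) * ⟨x, hx⟩ = ⟨t, htH⟩ := Subtype.ext hxn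
      have h3 : (⟨x, hx⟩ : H) = e := by
        rw [← (he ⟨x, hx⟩).1, ← hy, mul_assoc, h2]
      exact congrArg Subtype.val h3
    intro x hx y hy
    rw [key x hx, key y hy]

theorem coe_pow_eq {M : Type} [Monoid M] (x : M) : ∀ {n : ℕ}, 0 < n →
    (x : WithOne M) ^ n = (x ^ n : M)
  | 1, _ => by simp
  | n + 2, _ => by
    rw [pow_succ, coe_pow_eq x (Nat.succ_pos n), pow_succ x (n + 1), WithOne.coe_mul]

theorem of_mem_CR_iff {M : Type} [Monoid M] [Finite M] :
    of M ∈ CR ↔ ∀ x : M, ∃ n, 0 < n ∧ x ^ (n + 1) = x := by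
  rw [mem_CR_iff]
  refine forall_congr' fun x => exists_congr fun n => and_congr_right fun hn => ?_
  change ((x : M) : WithOne M) ^ (n + 1) = _ ↔ _
  rw [coe_pow_eq _ (Nat.succ_pos n), WithOne.coe_inj]

theorem of_mem_A_iff {M : Type} [Monoid M] [Finite M] :
    of M ∈ A ↔ ∀ x : M, ∃ n, 0 < n ∧ x ^ (n + 1) = x ^ n := by
  rw [mem_A_iff]
  refine forall_congr' fun x => exists_congr fun n => and_congr_right fun hn => ?_
  change ((x : M) : WithOne M) ^ (n + 1) = ((x : M) : WithOne M) ^ n ↔ _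
  rw [coe_pow_eq _ (Nat.succ_pos n), coe_pow_eq _ hn, WithOne.coe_inj]

/-- The canonical embedding of `(S × T)¹` in `S¹ × T¹`. -/
def withOneProd (S T : Type) [Semigroup S] [Semigroup T] :
    WithOne (S × T) →* WithOne S × WithOne T :=
  (WithOne.mapMulHom (MulHom.fst S T)).prod (WithOne.mapMulHom (MulHom.snd S T))

theorem withOneProd_injective (S T : Type) [Semigroup S] [Semigroup T] :
    Function.Injective (withOneProd S T) := by
  intro a b h
  have h1 : WithOne.mapMulHom (MulHom.fst S T) a = WithOne.mapMulHom (MulHom.fst S T) b :=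
    congrArg Prod.fst h
  have h2 : WithOne.mapMulHom (MulHom.snd S T) a = WithOne.mapMulHom (MulHom.snd S T) b :=
    congrArg Prod.snd h
  induction a using WithOne.recOneCoe with
  | one =>
    induction b using WithOne.recOneCoe with
    | one => rfl
    | coe b => simp at h1
  | coe a =>
    induction b using WithOne.recOneCoe with
    | one => simp at h1
    | coe b =>
      simp only [WithOne.mapMulHom_coe, WithOne.coe_inj] at h1 h2
      exact congrArg _ (Prod.ext h1 h2)

theorem withOne_prod_pow_eq {S T : Type} [Semigroup S] [Semigroup T] {x : S × T} {k l : ℕ}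
    (h : (x.1 : WithOne S) ^ k = (x.1 : WithOne S) ^ l)
    (h' : (x.2 : WithOne T) ^ k = (x.2 : WithOne T) ^ l) :
    (x : WithOne (S × T)) ^ k = (x : WithOne (S × T)) ^ l := by
  apply withOneProd_injective S T
  rw [map_pow, map_pow]
  exact Prod.ext h h'

theorem pow_mul_succ {M : Type} [Monoid M] {x : M} {n : ℕ} (h : x ^ (n + 1) = x) :
    ∀ m : ℕ, x ^ (n * m + 1) = x
  | 0 => by simp
  | m + 1 => by rw [mul_add_one, add_assoc, pow_add, h, ← pow_succ, pow_mul_succ h m]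

theorem pow_mul_succ_eq {M : Type} [Monoid M] {x : M} {n : ℕ} (h : x ^ (n + 1) = x ^ n)
    {m : ℕ} (hm : 0 < m) : x ^ (n * m + 1) = x ^ (n * m) := by
  obtain ⟨m, rfl⟩ := Nat.exists_eq_succ_of_ne_zero hm.ne'
  rw [Nat.succ_eq_add_one, mul_add_one, add_assoc, pow_add, h, ← pow_add]

theorem isPseudovariety_CR : IsPseudovariety CR where
  image_mem {S T} hS f hf := by
    rw [mem_CR_iff] at hS ⊢
    intro y
    obtain ⟨x, rfl⟩ := hf y
    obtain ⟨n, hn, h⟩ := hS x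
    exact ⟨n, hn, by simpa using congrArg (WithOne.mapMulHom f) h⟩
  sub_mem {S T} hT f hf := by
    rw [mem_CR_iff] at hT ⊢
    intro x
    obtain ⟨n, hn, h⟩ := hT (f x)
    exact ⟨n, hn, WithOne.mapMulHom_injective hf (by simpa using h)⟩
  trivial_mem := mem_CR_iff.2 fun _ => ⟨1, Nat.one_pos, rfl⟩
  prod_mem {S T} hS hT := by
    rw [mem_CR_iff] at hS hT ⊢
    intro x
    obtain ⟨n, hn, h⟩ := hS x.1
    obtain ⟨m, hm, h'⟩ := hT x.2
    refine ⟨n * m, Nat.mul_pos hn hm, (withOne_prod_pow_eq (l := 1) ?_ ?_).trans (pow_one _)⟩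
    · rw [pow_one, pow_mul_succ h]
    · rw [pow_one, mul_comm, pow_mul_succ h']

theorem isPseudovariety_A : IsPseudovariety A where
  image_mem {S T} hS f hf := by
    rw [mem_A_iff] at hS ⊢
    intro y
    obtain ⟨x, rfl⟩ := hf y
    obtain ⟨n, hn, h⟩ := hS x
    exact ⟨n, hn, by simpa using congrArg (WithOne.mapMulHom f) h⟩
  sub_mem {S T} hT f hf := by
    rw [mem_A_iff] at hT ⊢
    intro x
    obtain ⟨n, hn, h⟩ := hT (f x)
    exact ⟨n, hn, WithOne.mapMulHom_injective hf (by simpa using h)⟩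
  trivial_mem := mem_A_iff.2 fun _ => ⟨1, Nat.one_pos, rfl⟩
  prod_mem {S T} hS hT := by
    rw [mem_A_iff] at hS hT ⊢
    intro x
    obtain ⟨n, hn, h⟩ := hS x.1
    obtain ⟨m, hm, h'⟩ := hT x.2
    refine ⟨n * m, Nat.mul_pos hn hm, withOne_prod_pow_eq (pow_mul_succ_eq h hm) ?_⟩
    rw [mul_comm, pow_mul_succ_eq h' hn]

theorem exists_uniform_pow_of_mem_CR {S : FinSgp} (hS : S ∈ CR) :
    ∃ N, 0 < N ∧ ∀ x : S, (x : WithOne S) ^ (N + 1) = x := by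
  refine exists_uniform_pow fun x => ?_
  obtain ⟨n, hn, h⟩ := mem_CR_iff.1 hS x
  exact ⟨n, hn, fun m _ => pow_mul_succ h m⟩

end FinSgp

/-! ### Functoriality of `Plus` and `Minus` -/

namespace Plus

variable {M M' X : Type} [Monoid M] [Monoid M']

/-- Functoriality of `Plus`. -/
def map (X : Type) (f : M →* M') : Plus M X →* Plus M' X where
  toFun
    | el m => el (f m)
    | zero m x => zero (f m) x
  map_one' := congrArg el (map_one f)
  map_mul' := by rintro (_ | _) (_ | _) <;> simp

@[simp] theorem map_el (f : M →* M') (m : M) : map X f (el m) = el (f m) := rfl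
@[simp] theorem map_zero (f : M →* M') (m : M) (x : X) : map X f (zero m x) = zero (f m) x := rfl

theorem map_injective {f : M →* M'} (hf : Function.Injective f) :
    Function.Injective (map X f) := by
  rintro (_ | _) (_ | _) <;> simp [hf.eq_iff]

theorem map_surjective {f : M →* M'} (hf : Function.Surjective f) :
    Function.Surjective (map X f) := by
  rintro (m | ⟨m, x⟩) <;> obtain ⟨m, rfl⟩ := hf m
  · exact ⟨el m, rfl⟩
  · exact ⟨zero m x, rfl⟩

theorem el_pow (m : M) (n : ℕ) : (el m : Plus M X) ^ n = el (m ^ n) :=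
  (map_pow (⟨⟨el, rfl⟩, fun _ _ => rfl⟩ : M →* Plus M X) m n).symm

end Plus

namespace Minus

variable {M M' X : Type} [Monoid M] [Monoid M']

/-- Functoriality of `Minus`. -/
def map (X : Type) (f : M →* M') : Minus M X →* Minus M' X where
  toFun
    | el m => el (f m)
    | zero x m => zero x (f m)
  map_one' := congrArg el (map_one f)
  map_mul' := by rintro (_ | _) (_ | _) <;> simp

@[simp] theorem map_el (f : M →* M') (m : M) : map X f (el m) = el (f m) := rfl
@[simp] theorem map_zero (f : M →* M') (m : M) (x : X) : map X f (zero x m) = zero x (f m) := rfl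

theorem map_injective {f : M →* M'} (hf : Function.Injective f) :
    Function.Injective (map X f) := by
  rintro (_ | _) (_ | _) <;> simp [hf.eq_iff]

theorem map_surjective {f : M →* M'} (hf : Function.Surjective f) :
    Function.Surjective (map X f) := by
  rintro (m | ⟨x, m⟩) <;> obtain ⟨m, rfl⟩ := hf m
  · exact ⟨el m, rfl⟩
  · exact ⟨zero x m, rfl⟩

theorem el_pow (m : M) (n : ℕ) : (el m : Minus M X) ^ n = el (m ^ n) :=
  (map_pow (⟨⟨el, rfl⟩, fun _ _ => rfl⟩ : M →* Minus M X) m n).symm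

/-- The underlying element of `M`. -/
def base : Minus M X → M
  | el m => m
  | zero _ m => m

theorem base_mul_el (p : Minus M X) (m : M) : base (p * el m) = base p * m := by
  cases p <;> rfl

end Minus

/-! ### Closure of the complexity pseudovarieties under adjoining zeros -/

namespace FinSgp

/-- A class of finite semigroups that contains all aperiodic semigroups and is closed under
adjoining an identity element together with left zeros or right zeros. -/
structure ZeroClosed (V : Set FinSgp) : Prop where
  isPseudovariety : IsPseudovariety V
  aperiodic : A ⊆ V
  plus_mem : ∀ {S : FinSgp}, S ∈ V → ∀ (X : Type) [Finite X], of (Plus (WithOne S) X) ∈ V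
  minus_mem : ∀ {S : FinSgp}, S ∈ V → ∀ (X : Type) [Finite X], of (Minus (WithOne S) X) ∈ V

theorem plus_mem_A {M : Type} [Monoid M] [Finite M] (hM : of M ∈ A) (X : Type) [Finite X] :
    of (Plus M X) ∈ A := by
  rw [of_mem_A_iff] at hM ⊢
  rintro (m | ⟨m, x⟩)
  · obtain ⟨n, hn, h⟩ := hM m
    exact ⟨n, hn, by rw [Plus.el_pow, Plus.el_pow, h]⟩
  · exact ⟨1, Nat.one_pos, by rw [pow_succ, pow_one, Plus.zero_mul]⟩

theorem minus_mem_A {M : Type} [Monoid M] [Finite M] (hM : of M ∈ A) (X : Type) [Finite X] :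
    of (Minus M X) ∈ A := by
  rw [of_mem_A_iff] at hM ⊢
  rintro (m | ⟨x, m⟩)
  · obtain ⟨n, hn, h⟩ := hM m
    exact ⟨n, hn, by rw [Minus.el_pow, Minus.el_pow, h]⟩
  · exact ⟨1, Nat.one_pos, by rw [pow_succ, pow_one, Minus.mul_zero]⟩

theorem plus_mem_CR {M : Type} [Monoid M] [Finite M] (hM : of M ∈ CR) (X : Type) [Finite X] :
    of (Plus M X) ∈ CR := by
  rw [of_mem_CR_iff] at hM ⊢
  rintro (m | ⟨m, x⟩)
  · obtain ⟨n, hn, h⟩ := hM m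
    exact ⟨n, hn, by rw [Plus.el_pow, h]⟩
  · exact ⟨1, Nat.one_pos, by rw [pow_succ, pow_one, Plus.zero_mul]⟩

theorem minus_mem_CR {M : Type} [Monoid M] [Finite M] (hM : of M ∈ CR) (X : Type) [Finite X] :
    of (Minus M X) ∈ CR := by
  rw [of_mem_CR_iff] at hM ⊢
  rintro (m | ⟨x, m⟩)
  · obtain ⟨n, hn, h⟩ := hM m
    exact ⟨n, hn, by rw [Minus.el_pow, h]⟩
  · exact ⟨1, Nat.one_pos, by rw [pow_succ, pow_one, Minus.mul_zero]⟩

theorem withOne_mem_A {S : FinSgp} (hS : S ∈ A) : of (WithOne S) ∈ A := by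
  rw [of_mem_A_iff]
  intro x
  induction x using WithOne.recOneCoe with
  | one => exact ⟨1, Nat.one_pos, by simp⟩
  | coe x => exact mem_A_iff.1 hS x

theorem withOne_mem_CR {S : FinSgp} (hS : S ∈ CR) : of (WithOne S) ∈ CR := by
  rw [of_mem_CR_iff]
  intro x
  induction x using WithOne.recOneCoe with
  | one => exact ⟨1, Nat.one_pos, by simp⟩
  | coe x => exact mem_CR_iff.1 hS x

theorem zeroClosed_A : ZeroClosed A where
  isPseudovariety := isPseudovariety_A
  aperiodic := subset_rfl
  plus_mem hS X _ := plus_mem_A (withOne_mem_A hS) X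
  minus_mem hS X _ := minus_mem_A (withOne_mem_A hS) X

theorem mapMulHom_surjective {S T : Type} [Semigroup S] [Semigroup T] {f : S →ₙ* T}
    (hf : Function.Surjective f) : Function.Surjective (WithOne.mapMulHom f) := by
  intro y
  induction y using WithOne.recOneCoe with
  | one => exact ⟨1, map_one _⟩
  | coe y =>
    obtain ⟨x, rfl⟩ := hf y
    exact ⟨x, WithOne.mapMulHom_coe f x⟩

/-- This reduces closure of a generated pseudovariety under `Plus` to a check on its generators. -/
theorem isPseudovariety_plus {V : Set FinSgp} (hV : IsPseudovariety V) (hA : A ⊆ V) (X : Type)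
    [Finite X] : IsPseudovariety {S | of (Plus (WithOne S) X) ∈ V} where
  image_mem hS f hf := hV.of_surjective hS (Plus.map X (WithOne.mapMulHom f)).toMulHom
    (Plus.map_surjective (mapMulHom_surjective hf))
  sub_mem hT f hf := hV.of_injective hT (Plus.map X (WithOne.mapMulHom f)).toMulHom
    (Plus.map_injective (WithOne.mapMulHom_injective hf))
  trivial_mem := hA (plus_mem_A (withOne_mem_A isPseudovariety_A.trivial_mem) X)
  prod_mem {S T} hS hT := by
    let f := Plus.map X ((MonoidHom.fst _ _).comp (withOneProd S T))
    let g := Plus.map X ((MonoidHom.snd _ _).comp (withOneProd S T))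
    refine hV.of_injective (S := Plus (WithOne (S × T)) X) (hV.of_prod hS hT)
      (f.prod g).toMulHom ?_
    intro a b h
    have h1 : f a = f b := congrArg Prod.fst h
    have h2 : g a = g b := congrArg Prod.snd h
    rcases a with (a | ⟨a, x⟩) <;> rcases b with (b | ⟨b, y⟩) <;>
      simp only [f, g, Plus.map_el, Plus.map_zero, Plus.el.injEq, Plus.zero.injEq, reduceCtorEq]
        at h1 h2
    · exact congrArg _ (withOneProd_injective S T (Prod.ext h1 h2))
    · obtain rfl := h1.2
      exact congrArg (Plus.zero · x) (withOneProd_injective S T (Prod.ext h1.1 h2.1))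

theorem isPseudovariety_minus {V : Set FinSgp} (hV : IsPseudovariety V) (hA : A ⊆ V) (X : Type)
    [Finite X] : IsPseudovariety {S | of (Minus (WithOne S) X) ∈ V} where
  image_mem hS f hf := hV.of_surjective hS (Minus.map X (WithOne.mapMulHom f)).toMulHom
    (Minus.map_surjective (mapMulHom_surjective hf))
  sub_mem hT f hf := hV.of_injective hT (Minus.map X (WithOne.mapMulHom f)).toMulHom
    (Minus.map_injective (WithOne.mapMulHom_injective hf))
  trivial_mem := hA (minus_mem_A (withOne_mem_A isPseudovariety_A.trivial_mem) X)
  prod_mem {S T} hS hT := by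
    let f := Minus.map X ((MonoidHom.fst _ _).comp (withOneProd S T))
    let g := Minus.map X ((MonoidHom.snd _ _).comp (withOneProd S T))
    refine hV.of_injective (S := Minus (WithOne (S × T)) X) (hV.of_prod hS hT)
      (f.prod g).toMulHom ?_
    intro a b h
    have h1 : f a = f b := congrArg Prod.fst h
    have h2 : g a = g b := congrArg Prod.snd h
    rcases a with (a | ⟨x, a⟩) <;> rcases b with (b | ⟨y, b⟩) <;>
      simp only [f, g, Minus.map_el, Minus.map_zero, Minus.el.injEq, Minus.zero.injEq,
        reduceCtorEq] at h1 h2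
    · exact congrArg _ (withOneProd_injective S T (Prod.ext h1 h2))
    · obtain rfl := h1.1
      exact congrArg (Minus.zero x) (withOneProd_injective S T (Prod.ext h1.2 h2.2))

theorem semidirect_mem_star {V W : Set FinSgp} {S T : FinSgp} (hS : S ∈ V) (hT : T ∈ W)
    (φ : Action T S) : semidirect S T φ ∈ star V W :=
  fun _ _ hK => hK ⟨S, hS, T, hT, φ, rfl⟩

theorem subset_star {V W : Set FinSgp} (hW : trivial ∈ W) : V ⊆ star V W := by
  intro S hS
  let φ : Action trivial S := ⟨fun _ s => s, fun _ _ _ => rfl, fun _ _ _ => rfl, fun _ _ _ => rfl⟩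
  refine (isPseudovariety_generated _).sub_mem (semidirect_mem_star hS hW φ)
    ⟨fun s => (⟨s, PUnit.unit⟩ : Semidirect φ), fun _ _ => rfl⟩ fun s t h => ?_
  exact congrArg Semidirect.left h

instance {S T : Type} [Semigroup S] [Semigroup T] [Finite S] [Finite T] (φ : Action T S) :
    Finite (Semidirect φ) :=
  Finite.of_injective (fun p : Semidirect φ => (p.left, p.right)) fun _ _ h =>
    Semidirect.ext (congrArg Prod.fst h) (congrArg Prod.snd h)

/-- An embedding of the monoid `R` in a semidirect product of the monoids `M` and `N`. -/
structure SemidirectEmbedding (R M N : Type) [Monoid R] [Monoid M] [Monoid N] where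
  act : N →* Monoid.End M
  left : R → M
  right : R →* N
  left_mul : ∀ a b, left (a * b) = left a * act (right a) (left b)
  ext : ∀ a b, left a = left b → right a = right b → a = b

namespace SemidirectEmbedding

section

variable {R M N : Type} [Monoid R] [Monoid M] [Monoid N] (E : SemidirectEmbedding R M N)

theorem act_mul_apply (g h : N) (m : M) : E.act (g * h) m = E.act g (E.act h m) := by
  rw [map_mul]; rfl

theorem act_one_apply (m : M) : E.act 1 m = m := by rw [map_one]; rfl

/-- `Plus N Unit` acts on `Plus M X`; the left zeros act by the trivial endomorphism. -/
def plusAction (X : Type) : Action (Plus N Unit) (Plus M X) where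
  act
    | .el n => Plus.map X (E.act n)
    | .zero _ _ => fun _ => 1
  mul_act := by
    rintro (g | g) (h | h) (m | m)
    all_goals simp
    all_goals rfl
  act_mul := by rintro (g | g) <;> simp
  one_act := by
    intro e he
    obtain rfl : e = Plus.el 1 := (mul_one e).symm.trans (he 1).1
    rintro (m | m) <;> simp only [map_one] <;> rfl

/-- The embedding of `Plus R X` in a semidirect product of `Plus M X` and `Plus N Unit`. -/
def plusHom (X : Type) : Plus R X →ₙ* Semidirect (E.plusAction X) where
  toFun
    | .el a => ⟨.el (E.left a), .el (E.right a)⟩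
    | .zero a x => ⟨.zero (E.left a) x, .zero (E.right a) ()⟩
  map_mul' := by
    rintro (a | ⟨a, x⟩) (b | ⟨b, y⟩) <;> refine Semidirect.ext ?_ ?_
    · exact congrArg Plus.el (E.left_mul a b)
    · exact congrArg Plus.el (map_mul E.right a b)
    · exact congrArg (Plus.zero · y) (E.left_mul a b)
    · exact congrArg (Plus.zero · ()) (map_mul E.right a b)
    all_goals rfl

theorem plusHom_injective (X : Type) : Function.Injective (E.plusHom X) := by
  intro a b h
  have h1 := congrArg Semidirect.left h
  have h2 := congrArg Semidirect.right h
  rcases a with (a | ⟨a, x⟩) <;> rcases b with (b | ⟨b, y⟩)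
  · exact congrArg _ (E.ext a b (Plus.el.inj h1) (Plus.el.inj h2))
  · cases h1
  · cases h1
  · obtain ⟨h3, rfl⟩ := Plus.zero.inj h1
    exact congrArg (Plus.zero · x) (E.ext a b h3 (Plus.zero.inj h2).1)

/-- The action of a monoid on functions by translations of the argument. -/
def piAction (P Q : Type) [Monoid P] [Semigroup Q] : Action P (P → Q) where
  act t f p := f (p * t)
  mul_act t t' f := by funext p; simp only [mul_assoc]
  act_mul _ _ _ := rfl
  one_act e he f := by
    obtain rfl : e = 1 := (mul_one e).symm.trans (he 1).1
    funext p
    rw [mul_one]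

/-- The embedding of `Minus R X` in a wreath product of `Minus M X` and `Minus N Unit`. -/
def minusHom (X : Type) : Minus R X →ₙ* Semidirect (piAction (Minus N Unit) (Minus M X)) where
  toFun
    | .el a => ⟨fun p => .el (E.act p.base (E.left a)), .el (E.right a)⟩
    -- Right zeros must absorb whatever stands on their left. Constant functions are fixed by
    -- translations, whereas `E.act` itself would alter `E.left a`.
    | .zero x a => ⟨fun _ => .zero x (E.left a), .zero () (E.right a)⟩
  map_mul' := by
    rintro (a | ⟨x, a⟩) (b | ⟨y, b⟩) <;> refine Semidirect.ext ?_ ?_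
    · funext p
      refine congrArg Minus.el ?_
      rw [E.left_mul, map_mul, ← act_mul_apply, ← Minus.base_mul_el]
    · exact congrArg Minus.el (map_mul E.right a b)
    · rfl
    · rfl
    · funext p
      refine congrArg (Minus.zero x) ?_
      rw [E.left_mul]
      exact congrArg (fun q => _ * E.act (Minus.base q) _) (Minus.mul_zero _ _ p).symm
    · exact congrArg (Minus.zero ()) (map_mul E.right a b)
    · rfl
    · rfl

theorem minusHom_injective (X : Type) : Function.Injective (E.minusHom X) := by
  intro a b h
  have h1 := congrFun (congrArg Semidirect.left h) 1
  have h2 := congrArg Semidirect.right h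
  rcases a with (a | ⟨x, a⟩) <;> rcases b with (b | ⟨y, b⟩)
  · refine congrArg _ (E.ext a b ?_ (Minus.el.inj h2))
    have := Minus.el.inj h1
    rwa [Minus.one_def, Minus.base, act_one_apply, act_one_apply] at this
  · cases h1
  · cases h1
  · obtain ⟨rfl, h3⟩ := Minus.zero.inj h1
    exact congrArg (Minus.zero x) (E.ext a b h3 (Minus.zero.inj h2).2)

variable [Finite R] [Finite M] [Finite N] (X : Type) [Finite X] {V W : Set FinSgp}

theorem plus_mem_star (E : SemidirectEmbedding R M N) (hM : of (Plus M X) ∈ V)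
    (hN : of (Plus N Unit) ∈ W) : of (Plus R X) ∈ star V W :=
  (isPseudovariety_generated _).sub_mem (semidirect_mem_star hM hN (E.plusAction X))
    (E.plusHom X) (E.plusHom_injective X)

theorem minus_mem_star (E : SemidirectEmbedding R M N) (hV : IsPseudovariety V)
    (hM : of (Minus M X) ∈ V) (hN : of (Minus N Unit) ∈ W) : of (Minus R X) ∈ star V W :=
  (isPseudovariety_generated _).sub_mem
    (semidirect_mem_star (hV.of_pi hM (Minus N Unit)) hN (piAction (Minus N Unit) (Minus M X)))
    (E.minusHom X) (E.minusHom_injective X)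

end

section group

variable {R M H : Type} [Monoid R] [Monoid M] [Group H] (E : SemidirectEmbedding R M H)

/-- The group `H` acts on `Plus M (H × X)`. -/
def plusGroupAction (X : Type) : Action H (Plus M (H × X)) where
  act h
    | .el m => .el (E.act h m)
    | .zero m x => .zero (E.act h m) (h * x.1, x.2)
  mul_act := by rintro g h (m | m) <;> simp [mul_assoc]
  act_mul := by rintro g (m | m) (n | n) <;> simp
  one_act e he := by
    obtain rfl : e = 1 := (mul_one e).symm.trans (he 1).1
    rintro (m | m) <;> simp

/-- The relation by which `Plus R X` divides a semidirect product of `Plus M (H × X)` and `H`. -/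
def plusRel (X : Type) : Plus R X → Semidirect (E.plusGroupAction X) → Prop
  | .el a, p => p = ⟨.el (E.left a), E.right a⟩
  -- A nontrivial group has no left zeros, so the group coordinate of `p` is left free and `E.right
  -- a` is stored in the label of the zero instead.
  | .zero a x, p => p.left = .zero (E.left a) (E.right a, x)

/-- The right zeros of `Minus M (H × X)` that represent the right zero of `Minus R X` given by
`x` and `a`. -/
def rightZero {X : Type} (x : X) (a : R) (c : H) : Minus M (H × X) :=
  -- With `c` read as the group coordinate accumulated up to and including `a`, the factor `c *
  -- (E.right a)⁻¹` is the part that precedes `a`.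
  .zero (c * (E.right a)⁻¹, x) (E.act (c * (E.right a)⁻¹) (E.left a))

theorem rightZero_mul_el {X : Type} (x : X) (a b : R) (c : H) :
    E.rightZero x a c * .el (E.act c (E.left b)) = E.rightZero x (a * b) (c * E.right b) := by
  have h1 : c * E.right b * (E.right a * E.right b)⁻¹ = c * (E.right a)⁻¹ := by group
  have h2 : c * (E.right a)⁻¹ * E.right a = c := by group
  rw [rightZero, rightZero, map_mul E.right, h1, Minus.zero_mul_el, E.left_mul,
    map_mul (E.act _), ← act_mul_apply, h2]

theorem rightZero_inj {X : Type} {x y : X} {a b : R} {c : H}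
    (h : E.rightZero x a c = E.rightZero y b c) : x = y ∧ a = b := by
  obtain ⟨h1, h2⟩ := Minus.zero.inj h
  obtain ⟨h1, h3⟩ := Prod.mk.inj h1
  have h4 : E.right a = E.right b := inv_injective (mul_left_cancel h1)
  rw [← h4] at h2
  have h5 := congrArg (E.act (c * (E.right a)⁻¹)⁻¹) h2
  rw [← act_mul_apply, ← act_mul_apply, inv_mul_cancel, act_one_apply, act_one_apply] at h5
  exact ⟨h3, E.ext a b h5 h4⟩

/-- The relation by which `Minus R X` divides a wreath product of `Minus M (H × X)` and `H`. -/
def minusRel (X : Type) : Minus R X → Semidirect (piAction H (Minus M (H × X))) → Prop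
  | .el a, p => p = ⟨fun g => .el (E.act g (E.left a)), E.right a⟩
  -- Again the group coordinate is arbitrary; the function compensates for it, so that left factors
  -- only change the representative.
  | .zero x a, p => p.left = fun g => E.rightZero x a (g * p.right)

variable [Finite R] [Finite M] [Finite H] (X : Type) [Finite X] {V : Set FinSgp}

theorem of_mem_G (H : Type) [Group H] [Finite H] : of H ∈ G :=
  ⟨(1 : H), fun x => ⟨one_mul x, mul_one x⟩,
    fun x => ⟨(x⁻¹ : H), inv_mul_cancel x, mul_inv_cancel x⟩⟩

theorem plus_mem_star_G (E : SemidirectEmbedding R M H) (hM : of (Plus M (H × X)) ∈ V) :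
    of (Plus R X) ∈ star V G := by
  refine (isPseudovariety_generated _).mem_of_rel
    (semidirect_mem_star hM (of_mem_G H) (E.plusGroupAction X)) (E.plusRel X) ?_ ?_ ?_
  · rintro (a | ⟨a, x⟩)
    · exact ⟨_, rfl⟩
    · exact ⟨(⟨.zero (E.left a) (E.right a, x), 1⟩ : Semidirect (E.plusGroupAction X)), rfl⟩
  · rintro (a | ⟨a, x⟩) (b | ⟨b, y⟩) ⟨p, g⟩ ⟨q, h⟩ hp hq
    · cases hp
      cases hq
      refine Semidirect.ext ?_ ?_
      · exact congrArg Plus.el (E.left_mul a b).symm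
      · exact (map_mul E.right a b).symm
    · cases hp
      obtain rfl : q = _ := hq
      change Plus.zero _ _ = Plus.zero _ _
      rw [E.left_mul, map_mul]
    · obtain rfl : p = _ := hp
      rfl
    · obtain rfl : p = _ := hp
      rfl
  · rintro (a | ⟨a, x⟩) (b | ⟨b, y⟩) ⟨p, g⟩ hp hq
    · cases hp
      obtain ⟨h1, h2⟩ := Semidirect.mk.inj hq
      exact congrArg _ (E.ext a b (Plus.el.inj h1) h2)
    · cases hp
      cases hq
    · cases hq
      cases hp
    · obtain rfl : p = _ := hp
      obtain ⟨h1, h2⟩ := Plus.zero.inj hq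
      obtain ⟨h3, rfl⟩ := Prod.mk.inj h2
      exact congrArg (Plus.zero · x) (E.ext a b h1 h3)

theorem minus_mem_star_G (E : SemidirectEmbedding R M H) (hV : IsPseudovariety V)
    (hM : of (Minus M (H × X)) ∈ V) : of (Minus R X) ∈ star V G := by
  refine (isPseudovariety_generated _).mem_of_rel
    (semidirect_mem_star (hV.of_pi hM H) (of_mem_G H) (piAction H (Minus M (H × X))))
    (E.minusRel X) ?_ ?_ ?_
  · rintro (a | ⟨x, a⟩)
    · exact ⟨_, rfl⟩
    · exact ⟨(⟨fun g => E.rightZero x a (g * 1), 1⟩ :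
        Semidirect (piAction H (Minus M (H × X)))), rfl⟩
  · rintro (a | ⟨x, a⟩) (b | ⟨y, b⟩) ⟨p, (g : H)⟩ ⟨q, (h : H)⟩ hp hq
    · cases hp
      cases hq
      refine Semidirect.ext ?_ ?_
      · funext k
        refine congrArg Minus.el ?_
        change E.act k (E.left a) * E.act (k * E.right a) (E.left b) = E.act k (E.left (a * b))
        rw [E.left_mul, act_mul_apply, map_mul (E.act k)]
      · exact (map_mul E.right a b).symm
    · cases hp
      obtain rfl : q = fun k => E.rightZero y b (k * h) := hq
      funext k
      change E.rightZero y b (k * E.right a * h) = E.rightZero y b (k * (E.right a * h))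
      rw [mul_assoc]
    · obtain rfl : p = fun k => E.rightZero x a (k * g) := hp
      cases hq
      funext k
      change E.rightZero x a (k * g) * .el (E.act (k * g) (E.left b)) =
        E.rightZero x (a * b) (k * (g * E.right b))
      rw [rightZero_mul_el, mul_assoc]
    · obtain rfl : q = fun k => E.rightZero y b (k * h) := hq
      funext k
      change p k * E.rightZero y b (k * g * h) = E.rightZero y b (k * (g * h))
      rw [mul_assoc]
      exact Minus.mul_zero _ _ _
  · rintro (a | ⟨x, a⟩) (b | ⟨y, b⟩) ⟨p, (g : H)⟩ hp hq
    · cases hp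
      obtain ⟨h1, h2⟩ := Semidirect.mk.inj hq
      have h1 := Minus.el.inj (congrFun h1 1)
      rw [act_one_apply, act_one_apply] at h1
      exact congrArg _ (E.ext a b h1 h2)
    · cases hp
      cases congrFun hq 1
    · cases hq
      cases congrFun hp 1
    · obtain rfl : p = fun k => E.rightZero x a (k * g) := hp
      obtain ⟨rfl, rfl⟩ := E.rightZero_inj (congrFun hq 1)
      rfl

end group

end SemidirectEmbedding

section

variable {S T : Type} [Semigroup S] [Semigroup T] (φ : Action T S)

/-- The embedding of `(S * T)¹` in `S¹ * T¹`. -/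
def semidirectEmbedding : SemidirectEmbedding (WithOne (Semidirect φ)) (WithOne S) (WithOne T) where
  act := WithOne.lift
    ⟨fun t => WithOne.mapMulHom ⟨φ.act t, φ.act_mul t⟩, fun t t' => by
      refine MonoidHom.ext fun s => ?_
      induction s using WithOne.recOneCoe with
      | one => rfl
      | coe s => exact congrArg _ (φ.mul_act t t' s)⟩
  left := WithOne.recOneCoe 1 fun p => (p.left : WithOne S)
  right := WithOne.mapMulHom ⟨fun p => p.right, fun _ _ => rfl⟩
  left_mul a b := by
    induction a using WithOne.recOneCoe with
    | one => rw [one_mul, map_one, map_one]; exact (one_mul _).symm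
    | coe a =>
      induction b using WithOne.recOneCoe with
      | one => rw [mul_one]; exact (mul_one _).symm
      | coe b => rfl
  ext a b h h' := by
    induction a using WithOne.recOneCoe with
    | one =>
      induction b using WithOne.recOneCoe with
      | one => rfl
      | coe b => simp at h
    | coe a =>
      induction b using WithOne.recOneCoe with
      | one => simp at h
      | coe b =>
        simp only [WithOne.recOneCoe_coe, WithOne.mapMulHom_coe, WithOne.coe_inj] at h h'
        exact congrArg _ (Semidirect.ext h h')

end

/-- The action of a group `H` on `S¹` that extends an action on `S`. -/
def monoidAct {S H : Type} [Semigroup S] [Group H] (φ : Action H S) :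
    H →* Monoid.End (WithOne S) where
  toFun := fun t => WithOne.mapMulHom ⟨φ.act t, φ.act_mul t⟩
  map_one' := by
    refine MonoidHom.ext fun s => ?_
    induction s using WithOne.recOneCoe with
    | one => rfl
    | coe s => exact congrArg _ (φ.one_act 1 (fun t => ⟨one_mul t, mul_one t⟩) s)
  map_mul' := fun t t' => by
    refine MonoidHom.ext fun s => ?_
    induction s using WithOne.recOneCoe with
    | one => rfl
    | coe s => exact congrArg _ (φ.mul_act t t' s)

/-- The embedding of `(S * H)¹` in `S¹ * H` for a group `H`. -/
def semidirectGroupEmbedding {S H : Type} [Semigroup S] [Group H] (φ : Action H S) :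
    SemidirectEmbedding (WithOne (Semidirect φ)) (WithOne S) H where
  act := monoidAct φ
  left := WithOne.recOneCoe 1 fun p => (p.left : WithOne S)
  right := WithOne.lift ⟨fun p => p.right, fun _ _ => rfl⟩
  left_mul a b := by
    induction a using WithOne.recOneCoe with
    | one => rw [one_mul, map_one, map_one]; exact (one_mul _).symm
    | coe a =>
      induction b using WithOne.recOneCoe with
      | one => rw [mul_one]; exact (mul_one _).symm
      | coe b => rfl
  ext a b h h' := by
    induction a using WithOne.recOneCoe with
    | one =>
      induction b using WithOne.recOneCoe with
      | one => rfl
      | coe b => simp at h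
    | coe a =>
      induction b using WithOne.recOneCoe with
      | one => simp at h
      | coe b =>
        simp only [WithOne.recOneCoe_coe, WithOne.coe_inj] at h
        exact congrArg _ (Semidirect.ext h h')

/-- The group structure on a semigroup that is a group. -/
@[reducible]
noncomputable def IsGrp.group {S : Type} [Semigroup S] (h : IsGrp S) : Group S where
  one := h.choose
  inv x := (h.choose_spec.2 x).choose
  one_mul x := (h.choose_spec.1 x).1
  mul_one x := (h.choose_spec.1 x).2
  inv_mul_cancel x := (h.choose_spec.2 x).choose_spec.1

theorem ZeroClosed.star_A {V : Set FinSgp} (hV : ZeroClosed V) : ZeroClosed (star V A) := by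
  have hsub : A ⊆ star V A :=
    hV.aperiodic.trans (subset_star isPseudovariety_A.trivial_mem)
  have hps := isPseudovariety_generated {R | ∃ S ∈ V, ∃ T ∈ A, ∃ φ : Action T S,
    R = semidirect S T φ}
  refine ⟨hps, hsub, fun hS X _ => ?_, fun hS X _ => ?_⟩
  · refine hS _ (isPseudovariety_plus hps hsub X) ?_
    rintro _ ⟨S, hS, T, hT, φ, rfl⟩
    exact (semidirectEmbedding φ).plus_mem_star X (hV.plus_mem hS X)
      (zeroClosed_A.plus_mem hT Unit)
  · refine hS _ (isPseudovariety_minus hps hsub X) ?_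
    rintro _ ⟨S, hS, T, hT, φ, rfl⟩
    exact (semidirectEmbedding φ).minus_mem_star X hV.isPseudovariety (hV.minus_mem hS X)
      (zeroClosed_A.minus_mem hT Unit)

theorem trivial_mem_G : trivial ∈ G :=
  ⟨PUnit.unit, fun _ => ⟨rfl, rfl⟩, fun _ => ⟨PUnit.unit, rfl, rfl⟩⟩

/-- `Plus H Unit` and `Minus H Unit` are not groups, so the group coordinate of a zero moves into
its label. The closure of `V` is used for the label set `H × X`, which is why `ZeroClosed` allows
arbitrary finite label sets. -/
theorem ZeroClosed.star_G {V : Set FinSgp} (hV : ZeroClosed V) : ZeroClosed (star V G) := by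
  have hsub : A ⊆ star V G := hV.aperiodic.trans (subset_star trivial_mem_G)
  have hps := isPseudovariety_generated {R | ∃ S ∈ V, ∃ T ∈ G, ∃ φ : Action T S,
    R = semidirect S T φ}
  refine ⟨hps, hsub, fun hS X _ => ?_, fun hS X _ => ?_⟩
  · refine hS _ (isPseudovariety_plus hps hsub X) ?_
    rintro _ ⟨S, hS, H, hH, φ, rfl⟩
    let _ : Group H := IsGrp.group hH
    exact (semidirectGroupEmbedding φ).plus_mem_star_G X (hV.plus_mem hS (H × X))
  · refine hS _ (isPseudovariety_minus hps hsub X) ?_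
    rintro _ ⟨S, hS, H, hH, φ, rfl⟩
    let _ : Group H := IsGrp.group hH
    exact (semidirectGroupEmbedding φ).minus_mem_star_G X hV.isPseudovariety
      (hV.minus_mem hS (H × X))

theorem zeroClosed_C : ∀ n, ZeroClosed (C n)
  | 0 => zeroClosed_A
  | n + 1 => (zeroClosed_C n).star_G.star_A

end FinSgp

/-! ### Determining monoids inside a pseudovariety -/

namespace FinSgp

/-- A pseudovariety that is closed under the constructions `Plus` and `Minus` contains monoids that
determine the identities of `M` in any given number of letters. -/
theorem exists_determines {V : Set FinSgp} (hV : IsPseudovariety V)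
    (hplus : ∀ (M : Type) [Monoid M] [Finite M], of M ∈ V → of (Plus M Unit) ∈ V)
    (hminus : ∀ (M : Type) [Monoid M] [Finite M], of M ∈ V → of (Minus M Unit) ∈ V)
    {M : Type} [Monoid M] [Finite M] [Nontrivial M] (hM : of M ∈ V) (k : ℕ) :
    ∃ (M₁ : Type) (_ : Monoid M₁) (_ : Finite M₁) (_ : Nontrivial M₁), of M₁ ∈ V ∧
      OrdTheory.Determines M₁ M k := by
  induction k with
  | zero => exact ⟨M, _, ‹_›, ‹_›, hM, OrdTheory.determines_zero⟩
  | succ k ih =>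
    obtain ⟨M₁, _, _, _, h, hd⟩ := ih
    exact ⟨M × Plus M₁ Unit × Minus M₁ Unit, _, inferInstance, inferInstance,
      hV.of_prod hM (hV.of_prod (hplus M₁ h) (hminus M₁ h)), hd.succ⟩

end FinSgp

/-! ### Inequalities of ordered semigroups -/

namespace OrdFinSgp

open FreeMonoid OrdTheory FinSgp

/-- The value of a word in `T¹`. -/
def eval {T : Type} [Semigroup T] (η : ℕ → T) : FreeMonoid ℕ →* WithOne T :=
  lift fun x => (η x : WithOne T)

section eval

variable {T : Type} [Semigroup T]

@[simp] theorem eval_of (η : ℕ → T) (x : ℕ) : eval η (of x) = η x := lift_eval_of _ _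

theorem exists_eval_eq (η : ℕ → T) {u : FreeMonoid ℕ} (hu : u ≠ 1) :
    ∃ t : T, eval η u = t := by
  induction u using FreeMonoid.inductionOn' with
  | one => exact (hu rfl).elim
  | of_mul x u ih =>
    by_cases h : u = 1
    · exact ⟨η x, by rw [h, mul_one, eval_of]⟩
    · obtain ⟨t, ht⟩ := ih h
      exact ⟨η x * t, by rw [map_mul, ht, eval_of, WithOne.coe_mul]⟩

theorem eval_congr {η θ : ℕ → T} {u : FreeMonoid ℕ} (h : ∀ x ∈ u.symbols, η x = θ x) :
    eval η u = eval θ u :=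
  lift_congr fun x hx => congrArg _ (h x hx)

theorem eval_lift (η θ : ℕ → T) (σ : ℕ → FreeMonoid ℕ) (h : ∀ x, eval η (σ x) = θ x)
    (u : FreeMonoid ℕ) : eval η (lift σ u) = eval θ u := by
  rw [eval, lift_lift]
  exact congrArg (fun f => lift f u) (funext h)

end eval

/-- The order on `T¹` in which the adjoined identity element is incomparable with all other
elements. -/
def OneRel {T : Type} [PartialOrder T] (a b : WithOne T) : Prop :=
  (a = 1 ∧ b = 1) ∨ ∃ s t : T, a = s ∧ b = t ∧ s ≤ t

section OneRel

variable {T : OrdFinSgp} {a b c : WithOne T}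

theorem OneRel.refl (a : WithOne T) : OneRel a a := by
  induction a using WithOne.recOneCoe with
  | one => exact Or.inl ⟨rfl, rfl⟩
  | coe a => exact Or.inr ⟨a, a, rfl, rfl, le_rfl⟩

theorem oneRel_coe {s t : T} : OneRel (s : WithOne T) t ↔ s ≤ t := by
  constructor
  · rintro (⟨h, -⟩ | ⟨s', t', h, h', hle⟩)
    · exact (WithOne.coe_ne_one h).elim
    · rw [WithOne.coe_inj] at h h'
      rwa [h, h']
  · exact fun h => Or.inr ⟨s, t, rfl, rfl, h⟩

theorem OneRel.trans (h : OneRel a b) (h' : OneRel b c) : OneRel a c := by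
  obtain ⟨rfl, rfl⟩ | ⟨s, t, rfl, rfl, h⟩ := h
  · exact h'
  · obtain ⟨h', -⟩ | ⟨t', r, ht, rfl, h'⟩ := h'
    · exact (WithOne.coe_ne_one h').elim
    · rw [WithOne.coe_inj] at ht
      subst ht
      exact oneRel_coe.2 (h.trans h')

theorem OneRel.antisymm (h : OneRel a b) (h' : OneRel b a) : a = b := by
  obtain ⟨rfl, rfl⟩ | ⟨s, t, rfl, rfl, h⟩ := h
  · rfl
  · rw [oneRel_coe] at h'
    rw [le_antisymm h h']

theorem OneRel.mul_left (c : WithOne T) (h : OneRel a b) : OneRel (c * a) (c * b) := by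
  obtain ⟨rfl, rfl⟩ | ⟨s, t, rfl, rfl, h⟩ := h
  · exact .refl _
  · induction c using WithOne.recOneCoe with
    | one => simpa only [one_mul, oneRel_coe] using h
    | coe c => exact oneRel_coe.2 (T.stable c s t h).2

theorem OneRel.mul_right (c : WithOne T) (h : OneRel a b) : OneRel (a * c) (b * c) := by
  obtain ⟨rfl, rfl⟩ | ⟨s, t, rfl, rfl, h⟩ := h
  · exact .refl _
  · induction c using WithOne.recOneCoe with
    | one => simpa only [mul_one, oneRel_coe] using h
    | coe c => exact oneRel_coe.2 (T.stable c s t h).1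

end OneRel

theorem coe_pow_succ_eq {S : Type} [Semigroup S] {N : ℕ}
    (h : ∀ x : S, (x : WithOne S) ^ (N + 1) = x) (a : WithOne S) : a ^ (N + 1) = a := by
  induction a using WithOne.recOneCoe with
  | one => exact one_pow _
  | coe a => exact h a

/-- The inequalities satisfied by a completely regular ordered semigroup. -/
def theory (T : OrdFinSgp) (N : ℕ) (hN : 0 < N)
    (hT : ∀ x : T, (x : WithOne T) ^ (N + 1) = x) : OrdTheory where
  le u v := ∀ η : ℕ → T, OneRel (eval η u) (eval η v)
  N := N
  N_pos := hN
  refl u η := .refl _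
  trans h h' η := (h η).trans (h' η)
  mul_left w h η := by simpa only [map_mul] using (h η).mul_left _
  mul_right w h η := by simpa only [map_mul] using (h η).mul_right _
  subst σ hσ h η := by
    -- Nonerasing substitutions have values in `T` itself, so they compose to an assignment in `T`.
    choose θ hθ using fun x => exists_eval_eq η (hσ x)
    rw [eval_lift η θ σ hθ, eval_lift η θ σ hθ]
    exact h θ
  pow_le u η := by rw [map_pow, coe_pow_succ_eq hT]; exact .refl _
  le_pow u η := by rw [map_pow, coe_pow_succ_eq hT]; exact .refl _

/-- A monoid that divides an ordered semigroup is a model of its theory. -/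
theorem theory_models {T : OrdFinSgp} {N : ℕ} {hN : 0 < N}
    {hT : ∀ x : T, (x : WithOne T) ^ (N + 1) = x} {M : Type} [Monoid M] (r : M → T → Prop)
    (total : ∀ s, ∃ t, r s t) (mul : ∀ s s' t t', r s t → r s' t' → r (s * s') (t * t'))
    (inj : ∀ s s' t, r s t → r s' t → s = s') : (T.theory N hN hT).Models M := by
  intro u v huv η
  choose θ hθ using fun x => total (η x)
  -- The empty word is separate: its value is the adjoined identity of `T¹`, which represents no
  -- element of `M`.
  have key : ∀ w : FreeMonoid ℕ, (w = 1 ∧ eval θ w = 1) ∨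
      ∃ t : T, eval θ w = t ∧ r (lift η w) t := by
    intro w
    induction w using FreeMonoid.inductionOn' with
    | one => exact Or.inl ⟨rfl, map_one _⟩
    | of_mul x w ih =>
      right
      obtain ⟨rfl, -⟩ | ⟨t, ht, hr⟩ := ih
      · exact ⟨θ x, by simp, by simpa using hθ x⟩
      · refine ⟨θ x * t, by rw [map_mul, ht, eval_of, WithOne.coe_mul], ?_⟩
        rw [map_mul, lift_eval_of]
        exact mul _ _ _ _ (hθ x) hr
  have he : eval θ u = eval θ v :=
    ((q_eq_iff.1 huv).1 θ).antisymm ((q_eq_iff.1 huv).2 θ)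
  obtain ⟨rfl, hu⟩ | ⟨t, ht, hr⟩ := key u <;> obtain ⟨rfl, hv⟩ | ⟨t', ht', hr'⟩ := key v
  · rfl
  · rw [hu, ht'] at he
    exact (WithOne.one_ne_coe he).elim
  · rw [hv, ht] at he
    exact (WithOne.coe_ne_one he).elim
  · rw [ht, ht', WithOne.coe_inj] at he
    exact inj _ _ _ hr (he ▸ hr')

/-- A power of an ordered semigroup. -/
def pi (ι : Type) [Finite ι] (T : OrdFinSgp) : OrdFinSgp where
  toFinSgp := of (ι → T)
  order := inferInstanceAs (PartialOrder (ι → T))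
  stable a s t h := ⟨fun i => (T.stable (a i) (s i) (t i) (h i)).1,
    fun i => (T.stable (a i) (s i) (t i) (h i)).2⟩

theorem IsPseudovariety.pi_mem {W : Set OrdFinSgp} (hW : IsPseudovariety W) {T : OrdFinSgp}
    (hT : T ∈ W) (ι : Type) [Finite ι] : pi ι T ∈ W := by
  suffices h : ∀ _ : Finite ι, pi ι T ∈ W from h inferInstance
  refine Finite.induction_empty_option (P := fun ι => ∀ _ : Finite ι, pi ι T ∈ W) ?_ ?_ ?_ ι
  · intro α β e h _
    have := Finite.of_equiv β e.symm
    refine hW.sub_mem (h this) (⟨fun f => f ∘ e, fun _ _ => rfl⟩ : (β → T) →ₙ* (α → T))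
      fun f g => ⟨fun hfg b => ?_, fun hfg a => hfg (e a)⟩
    have h1 : f (e (e.symm b)) ≤ g (e (e.symm b)) := hfg (e.symm b)
    rwa [e.apply_symm_apply] at h1
  · intro _
    refine hW.sub_mem hW.trivial_mem
      (⟨fun _ => PUnit.unit, fun _ _ => rfl⟩ : (PEmpty → T) →ₙ* PUnit.{1})
      fun f g => ⟨fun _ x => x.elim, fun _ => le_refl PUnit.unit.{1}⟩
  · intro α _ h _
    refine hW.sub_mem (hW.prod_mem hT (h inferInstance))
      (⟨fun f => (f none, fun a => f (some a)), fun _ _ => rfl⟩ : (Option α → T) →ₙ* T × (α → T))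
      fun f g => ⟨fun hfg a => ?_, fun hfg => ⟨hfg none, fun a => hfg (some a)⟩⟩
    cases a with
    | none => exact hfg.1
    | some a => exact hfg.2 a

/-- If the inequalities of an ordered semigroup `T` in sufficiently many letters are identities of
`S`, then `S` with any stable order belongs to the pseudovariety generated by `T`. -/
theorem IsPseudovariety.mem_of_inequalities {W : Set OrdFinSgp} (hW : IsPseudovariety W)
    {T : OrdFinSgp} (hT : T ∈ W) (S : OrdFinSgp)
    (h : ∀ u v : FreeMonoid ℕ, (∀ η : ℕ → T, OneRel (eval η u) (eval η v)) →
      (u.symbols ∪ v.symbols).card ≤ Nat.card S → ∀ η : ℕ → S, eval η u = eval η v) : S ∈ W := by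
  let e := Finite.equivFin S
  let c : ℕ → S := fun x => if hx : x < Nat.card S then e.symm ⟨x, hx⟩ else Classical.arbitrary S
  have hc : ∀ s, c (e s) = s := fun s => by simp [c]
  have hc' : ∀ x, x < Nat.card S → (e (c x) : ℕ) = x := fun x hx => by simp [c, hx]
  -- Pairs of values of one word in letters indexing the elements of `S`: under all assignments in
  -- `T`, and under the tautological one in `S`. By `key` the first component determines the second,
  -- so `P` is the graph of the canonical map onto `S` from the relatively free semigroup.
  let P : Subsemigroup (((S → T) → T) × S) :=
    { carrier := {p | ∃ u : FreeMonoid ℕ, (∀ x ∈ u.symbols, x < Nat.card S) ∧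
        (∀ θ : S → T, eval (θ ∘ c) u = p.1 θ) ∧ eval c u = p.2}
      mul_mem' := by
        rintro p q ⟨u, hu, hp, hp'⟩ ⟨v, hv, hq, hq'⟩
        refine ⟨u * v, fun x hx => ?_, fun θ => ?_, ?_⟩
        · rw [symbols_mul, Finset.mem_union] at hx
          exact hx.elim (hu x) (hv x)
        · rw [map_mul, hp, hq]
          rfl
        · rw [map_mul, hp', hq']
          rfl }
  have key : ∀ p q : P, (∀ θ, p.1.1 θ ≤ q.1.1 θ) → p.1.2 = q.1.2 := by
    rintro ⟨p, u, hu, hp, hp'⟩ ⟨q, v, hv, hq, hq'⟩ hle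
    have h1 : eval c u = eval c v := by
      refine h u v (fun η => ?_) ?_ c
      · have hη : ∀ w : FreeMonoid ℕ, (∀ x ∈ w.symbols, x < Nat.card S) →
            eval η w = eval ((fun s => η (e s)) ∘ c) w := fun w hw =>
          eval_congr fun x hx => by rw [Function.comp_apply, hc' x (hw x hx)]
        rw [hη u hu, hη v hv, hp, hq]
        exact oneRel_coe.2 (hle _)
      · rw [← Finset.card_range (Nat.card S)]
        refine Finset.card_le_card fun x hx => ?_
        rw [Finset.mem_union] at hx
        exact Finset.mem_range.2 (hx.elim (hu x) (hv x))
    rw [hp', hq'] at h1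
    exact WithOne.coe_injective h1
  have gen : ∀ s : S, ((fun θ : S → T => θ s, s) : ((S → T) → T) × S) ∈ P := by
    intro s
    refine ⟨of (e s : ℕ), fun x hx => ?_, fun θ => ?_, ?_⟩
    · rw [symbols_of, Finset.mem_singleton] at hx
      exact hx ▸ (e s).2
    · rw [eval_of, Function.comp_apply, hc]
    · rw [eval_of, hc]
  have : Nonempty P := ⟨⟨_, gen (Classical.arbitrary S)⟩⟩
  -- The order ignores the `S`-coordinate, so `O` embeds in a power of `T`; since comparable
  -- elements have equal images in `S`, the projection is isotone whatever the order of `S`.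
  let O : OrdFinSgp :=
    { toFinSgp := FinSgp.of P
      order := PartialOrder.lift (fun p : P => p.1.1) fun p q hpq =>
        Subtype.ext (Prod.ext hpq (key p q fun θ => (congrFun hpq θ).le))
      stable := fun a s t hst => ⟨fun θ => (T.stable (a.1.1 θ) _ _ (hst θ)).1,
        fun θ => (T.stable (a.1.1 θ) _ _ (hst θ)).2⟩ }
  have hO : O ∈ W := hW.sub_mem (hW.pi_mem hT (S → T))
    (⟨fun p => p.1.1, fun _ _ => rfl⟩ : P →ₙ* ((S → T) → T)) fun _ _ => Iff.rfl
  refine hW.image_mem hO (⟨fun p => p.1.2, fun _ _ => rfl⟩ : P →ₙ* S) ?_ fun s => ⟨⟨_, gen s⟩, rfl⟩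
  intro p q hpq
  exact (key p q hpq).le

end OrdFinSgp

/-! ### Order primitivity -/

namespace FinSgp

/-- Every member of the pseudovariety generated by a pseudovariety of ordered semigroups divides
one of its members. -/
theorem exists_rel_of_mem_generated {W : Set OrdFinSgp} (hW : OrdFinSgp.IsPseudovariety W)
    {S : FinSgp} (hS : S ∈ generated (OrdFinSgp.toFinSgp '' W)) :
    ∃ T ∈ W, ∃ r : S → T → Prop, (∀ s, ∃ t, r s t) ∧
      (∀ s s' t t', r s t → r s' t' → r (s * s') (t * t')) ∧
      ∀ s s' t, r s t → r s' t → s = s' := by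
  refine hS {S | ∃ T ∈ W, ∃ r : S → T → Prop, (∀ s, ∃ t, r s t) ∧
      (∀ s s' t t', r s t → r s' t' → r (s * s') (t * t')) ∧
      ∀ s s' t, r s t → r s' t → s = s'} ⟨?_, ?_, ?_, ?_⟩ ?_
  · rintro S S' ⟨T, hT, r, total, mul, inj⟩ f hf
    refine ⟨T, hT, fun s' t => ∃ s, f s = s' ∧ r s t, fun s' => ?_, ?_, ?_⟩
    · obtain ⟨s, rfl⟩ := hf s'
      obtain ⟨t, ht⟩ := total s
      exact ⟨t, s, rfl, ht⟩
    · rintro _ _ t t' ⟨s, rfl, h⟩ ⟨s', rfl, h'⟩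
      exact ⟨s * s', map_mul f s s', mul _ _ _ _ h h'⟩
    · rintro _ _ t ⟨s, rfl, h⟩ ⟨s', rfl, h'⟩
      rw [inj _ _ _ h h']
  · rintro S S' ⟨T, hT, r, total, mul, inj⟩ f hf
    refine ⟨T, hT, fun s t => r (f s) t, fun s => total _, fun s s' t t' h h' => ?_,
      fun s s' t h h' => hf (inj _ _ _ h h')⟩
    simp only [map_mul]
    exact mul _ _ _ _ h h'
  · exact ⟨_, hW.trivial_mem, Eq, fun s => ⟨s, rfl⟩, by rintro _ _ _ _ rfl rfl; rfl,
      by rintro _ _ _ rfl rfl; rfl⟩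
  · rintro S S' ⟨T, hT, r, total, mul, inj⟩ ⟨T', hT', r', total', mul', inj'⟩
    refine ⟨_, hW.prod_mem hT hT', fun s t => r s.1 t.1 ∧ r' s.2 t.2, fun s => ?_,
      fun s s' t t' h h' => ⟨mul _ _ _ _ h.1 h'.1, mul' _ _ _ _ h.2 h'.2⟩,
      fun s s' t h h' => Prod.ext (inj _ _ _ h.1 h'.1) (inj' _ _ _ h.2 h'.2)⟩
    obtain ⟨t, ht⟩ := total s.1
    obtain ⟨t', ht'⟩ := total' s.2
    exact ⟨(t, t'), ht, ht'⟩
  · rintro _ ⟨T, hT, rfl⟩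
    exact ⟨T, hT, Eq, fun s => ⟨s, rfl⟩, by rintro _ _ _ _ rfl rfl; rfl,
      by rintro _ _ _ rfl rfl; rfl⟩

/-- A pseudovariety of completely regular semigroups that is closed under adjoining an identity
element, and left zeros or right zeros on which a monoid acts, is order primitive. -/
theorem IsPseudovariety.isOrderPrimitive {V : Set FinSgp} (hV : IsPseudovariety V) (hCR : V ⊆ CR)
    (hone : ∀ {S : FinSgp}, S ∈ V → of (WithOne S) ∈ V)
    (hplus : ∀ (M : Type) [Monoid M] [Finite M], of M ∈ V → of (Plus M Unit) ∈ V)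
    (hminus : ∀ (M : Type) [Monoid M] [Finite M], of M ∈ V → of (Minus M Unit) ∈ V) :
    IsOrderPrimitive V := by
  refine ⟨hV, ?_⟩
  rintro ⟨W, hW, hlt, hgen⟩
  refine hlt.2 fun S hS => ?_
  -- Nontriviality provides the two distinct left zeros needed in the induction.
  have : Nontrivial (WithOne S) := ⟨(Classical.arbitrary S : S), 1, WithOne.coe_ne_one⟩
  -- As many letters as `S` has elements suffice, because `S` is generated by its elements.
  obtain ⟨M₁, _, _, _, hM₁, hd⟩ := exists_determines hV hplus hminus (hone hS) (Nat.card S)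
  rw [← hgen] at hM₁
  obtain ⟨T, hT, r, total, mul, inj⟩ := exists_rel_of_mem_generated hW hM₁
  obtain ⟨N, hN, hTN⟩ := exists_uniform_pow_of_mem_CR (hCR (hlt.1 hT))
  refine hW.mem_of_inequalities hT S fun u v huv hc η => ?_
  exact hd (T.theory N hN hTN) (OrdFinSgp.theory_models r total mul inj) u v huv hc _

theorem ZeroClosed.plus_mem_of_monoid {V : Set FinSgp} (hV : ZeroClosed V) {M : Type} [Monoid M]
    [Finite M] (hM : of M ∈ V) : of (Plus M Unit) ∈ V :=
  hV.isPseudovariety.of_surjective (hV.plus_mem hM Unit)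
    (Plus.map Unit (WithOne.lift (MulHom.id M))).toMulHom
    (Plus.map_surjective fun m => ⟨m, WithOne.lift_coe _ _⟩)

theorem ZeroClosed.minus_mem_of_monoid {V : Set FinSgp} (hV : ZeroClosed V) {M : Type} [Monoid M]
    [Finite M] (hM : of M ∈ V) : of (Minus M Unit) ∈ V :=
  hV.isPseudovariety.of_surjective (hV.minus_mem hM Unit)
    (Minus.map Unit (WithOne.lift (MulHom.id M))).toMulHom
    (Minus.map_surjective fun m => ⟨m, WithOne.lift_coe _ _⟩)

theorem ZeroClosed.withOne_mem {V : Set FinSgp} (hV : ZeroClosed V) {S : FinSgp} (hS : S ∈ V) :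
    of (WithOne S) ∈ V :=
  hV.isPseudovariety.of_injective (hV.plus_mem hS Unit) ⟨Plus.el, fun _ _ => rfl⟩
    fun _ _ h => Plus.el.inj h

end FinSgp

theorem corollaryc (n : ℕ) : IsOrderPrimitive (FinSgp.CR ∩ FinSgp.C n) := by
  have hC := FinSgp.zeroClosed_C n
  exact (FinSgp.isPseudovariety_inter FinSgp.isPseudovariety_CR hC.isPseudovariety).isOrderPrimitive
    Set.inter_subset_left
    (fun hS => ⟨FinSgp.withOne_mem_CR hS.1, hC.withOne_mem hS.2⟩)
    (fun M _ _ hM => ⟨FinSgp.plus_mem_CR hM.1 Unit, hC.plus_mem_of_monoid hM.2⟩)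
    (fun M _ _ hM => ⟨FinSgp.minus_mem_CR hM.1 Unit, hC.minus_mem_of_monoid hM.2⟩)
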